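/- **Notation.** Let $k$ be a positive integer. For an element $x$ of a commutative ring and an integer $n\ge 0$ put $x^{\underline{n}}=x(x-1)\cdots(x-n+1)$, and let $\Delta_k^n=\{(t_1,\dots,t_k)\in\mathbb Z_{\ge 0}^k:\ t_1+\dots+t_k\le n\}$. The graph $\mathcal{SY}_k$ has as vertices the vectors $(c_1,\dots,c_k)$ of integers with $c_1\ge c_2\ge\dots\ge c_k\ge 0$ such that $c_i=c_j$ with $i\ne j$ implies $c_i=0$. Its directed edges increase one coordinate by $1$. Let $\mathcal M$ be the set of rational functions $p/\prod_{i<j}(x_i+x_j)$ with $p\in\mathbb Q[x_1,\dots,x_k]$. *Values.* The value of $f\in\mathcal M$ at a point with non-negative integer coordinates is obtained by substitution if all the coordinates are positive. If some coordinates vanish, they are replaced, in the order of their indices, by $t,t^2,t^3,\dots$, and the value is the limit as $t\to+0$, when it exists. *Components.* Expand $f\in\mathcal M$ in a Laurent series in $x_1,x_2/x_1,\dots,x_k/x_{k-1}$, that is, $(x_i+x_j)^{-1}=x_i^{-1}-x_jx_i^{-2}+x_j^2x_i^{-3}-\cdots$ for $i<j$. Then $f=P[f]+Q[f]$ uniquely,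 where the polynomial component $P[f]$ is a polynomial and every monomial in the expansion of the antipolynomial component $Q[f]$ contains some variable in a negative power. **Setting.** Let $v=(m_1,\dots,m_k)$ and $u=(n_1,\dots,n_k)$ be vertices of $\mathcal{SY}_k$ with $n_i\ge m_i$ for all $i$, put $m=\sum m_i$ and $n=\sum n_i$, and let $\ell$ be the number of non-zero $m_i$, so that $m_1>\dots>m_\ell>0=m_{\ell+1}=\dots=m_k$. Put $$\psi_v(x_1,\dots,x_k)=\frac1{(k-\ell)!}\sum_{\pi\in S_k}\ \prod_{i\le\ell}x_{\pi_i}^{\underline{m_i}}\prod_{i\le \ell,\ i<j}\frac{x_{\pi_i}+x_{\pi_j}}{x_{\pi_i}-x_{\pi_j}},\qquad \varphi_v=\prod_{i<j}\frac{x_i-x_j}{x_i+x_j}\cdot\psi_v,$$ $$g=\varphi_v\cdot(x_1+\dots+x_k-m)^{\underline{n-m}}.$$ **Theorem.** The function $\psi_v$ is a polynomial, so that $\varphi_v$ and $g$ belong to $\mathcal M$, and $\varphi_v$ has a (rational) value at every point of $\mathbb Z_{\ge0}^k$. Moreover: 1. The antipolynomial component $Q[g]$ has the value $0$ at every point of $\Delta_k^n$.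 2. The polynomial component of $g$ is $$P[g]=\sum_{c_1+\dots+c_k=n,\ c_i\ge0}\frac{(n-m)!}{\prod_i c_i!}\,\varphi_v(c_1,\dots,c_k)\prod_{i=1}^k x_i^{\underline{c_i}}.$$ 3. The number of directed paths from $v$ to $u$ in $\mathcal{SY}_k$ is finite and equals $$\frac{(n-m)!}{\prod_i n_i!}\,\varphi_v(n_1,\dots,n_k).$$ -/

import Mathlib

namespace StrictPaths

/-! ### The graph of strict partitions -/

/-- Vertices of `SY_k`: non-increasing vectors of `k` non-negative integers in which
two different coordinates can be equal only if they vanish. -/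
def SY (k : ℕ) : Type :=
  {c : Fin k → ℕ // Antitone c ∧ ∀ i j, i ≠ j → c i = c j → c i = 0}

/-- Edges of `SY_k`: one coordinate is increased by one. -/
instance (k : ℕ) : Quiver (SY k) where
  Hom c d := {i : Fin k // d.1 = c.1 + Pi.single i 1}

/-! ### Rational functions -/

/-- The field of rational functions in `x_1, …, x_k` with rational coefficients. -/
abbrev RatFun (k : ℕ) : Type := FractionRing (MvPolynomial (Fin k) ℚ)

/-- The variable `x_i` as a rational function. -/
noncomputable def x {k : ℕ} (i : Fin k) : RatFun k :=
  algebraMap (MvPolynomial (Fin k) ℚ) (RatFun k) (MvPolynomial.X i)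

/-- The falling factorial `a (a - 1) ⋯ (a - n + 1)`. -/
noncomputable def ff {R : Type} [CommRing R] (a : R) (n : ℕ) : R :=
  (descPochhammer R n).eval a

/-- The pairs `(i, j)` with `i < j`. -/
def pairs (k : ℕ) : Finset (Fin k × Fin k) :=
  Finset.univ.filter fun p => p.1 < p.2

/-- The common denominator `∏_{i < j} (x_i + x_j)`. -/
noncomputable def denom (k : ℕ) : MvPolynomial (Fin k) ℚ :=
  ∏ p ∈ pairs k, (MvPolynomial.X p.1 + MvPolynomial.X p.2)

/-- The number `ℓ` of non-zero coordinates of `v`. -/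
def len {k : ℕ} (v : Fin k → ℕ) : ℕ :=
  (Finset.univ.filter fun i => v i ≠ 0).card

/-- Okounkov's function
`ψ_v = 1 / (k - ℓ)! * ∑_π ∏_{i ≤ ℓ} ff (x_{π i}) (v i) * ∏_{i ≤ ℓ, i < j}
  (x_{π i} + x_{π j}) / (x_{π i} - x_{π j})`.
The indices are `0, …, k - 1` here, so that `i ≤ ℓ` becomes `(i : ℕ) < len v`. -/
noncomputable def psi {k : ℕ} (v : Fin k → ℕ) : RatFun k :=
  ((k - len v).factorial : RatFun k)⁻¹ *
    ∑ π : Equiv.Perm (Fin k),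
      (∏ i ∈ Finset.univ.filter (fun i : Fin k => (i : ℕ) < len v), ff (x (π i)) (v i)) *
        ∏ p ∈ (pairs k).filter (fun p => (p.1 : ℕ) < len v),
          (x (π p.1) + x (π p.2)) / (x (π p.1) - x (π p.2))

/-- `φ_v = ∏_{i < j} (x_i - x_j) / (x_i + x_j) * ψ_v`. -/
noncomputable def phi {k : ℕ} (v : Fin k → ℕ) : RatFun k :=
  (∏ p ∈ pairs k, (x p.1 - x p.2) / (x p.1 + x p.2)) * psi v

/-! ### Values of functions with denominator `∏_{i < j} (x_i + x_j)` -/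

/-- The point `c` with its vanishing coordinates replaced, in the order of the indices,
by `t, t ^ 2, t ^ 3, …`. -/
noncomputable def perturb {k : ℕ} (c : Fin k → ℕ) (t : ℝ) (i : Fin k) : ℝ :=
  if c i = 0 then t ^ (Finset.univ.filter fun j => j ≤ i ∧ c j = 0).card else c i

/-- `f` is a rational function with denominator `∏_{i < j} (x_i + x_j)`, and its value at the
point `c` (the limit along `perturb c t` as `t` tends to `+0`) exists and equals `y`. -/
def HasValueAt {k : ℕ} (f : RatFun k) (c : Fin k → ℕ) (y : ℚ) : Prop :=
  ∃ p : MvPolynomial (Fin k) ℚ,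
    f = algebraMap _ (RatFun k) p / algebraMap _ (RatFun k) (denom k) ∧
    Filter.Tendsto
      (fun t : ℝ => MvPolynomial.aeval (perturb c t) p / MvPolynomial.aeval (perturb c t) (denom k))
      (nhdsWithin 0 (Set.Ioi 0)) (nhds (y : ℝ))

/-! ### Laurent expansions -/

/-- Exponent vectors of Laurent monomials, compared lexicographically starting from the last
coordinate. The exponent vectors of `x_1, x_2 / x_1, …, x_k / x_{k-1}` are all positive. -/
abbrev Expo (k : ℕ) : Type := Lex ((Fin k)ᵒᵈ → ℤ)

/-- The vector `c` as an element of `Expo k`. -/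
def expo {k : ℕ} (c : Fin k → ℤ) : Expo k := toLex fun i => c (OrderDual.ofDual i)

/-- The field of formal series in which rational functions are expanded. -/
abbrev Laurent (k : ℕ) : Type := HahnSeries (Expo k) ℚ

/-- A polynomial as a (finite) formal series: `x_i` goes to the monomial `x_i`. -/
noncomputable def polyToLaurent (k : ℕ) : MvPolynomial (Fin k) ℚ →+* Laurent k :=
  MvPolynomial.eval₂Hom HahnSeries.C fun i => HahnSeries.single (expo (Pi.single i 1)) 1

/-- The exponent vector of an ordinary monomial. -/
def natExpo {k : ℕ} (s : Fin k →₀ ℕ) : Expo k := expo fun i => (s i : ℤ)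

theorem natExpo_injective {k : ℕ} : Function.Injective (natExpo (k := k)) := by
  intro s t h
  ext i
  have := congrFun (congrArg ofLex h) (OrderDual.toDual i)
  simpa [natExpo, expo] using this

theorem polyToLaurent_monomial {k : ℕ} (s : Fin k →₀ ℕ) (a : ℚ) :
    polyToLaurent k (MvPolynomial.monomial s a) = HahnSeries.single (natExpo s) a := by
  have h : ∀ S : Finset (Fin k), (∏ i ∈ S,
      (HahnSeries.single (expo (Pi.single i 1)) 1 : Laurent k) ^ s i) =
      HahnSeries.single (∑ i ∈ S, s i • expo (Pi.single i 1)) 1 := by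
    intro S
    induction S using Finset.induction_on with
    | empty => simp
    | insert i S hi ih =>
      rw [Finset.prod_insert hi, Finset.sum_insert hi, ih, HahnSeries.single_pow,
        HahnSeries.single_mul_single]
      simp
  have h2 : (∑ i, s i • expo (Pi.single i 1)) = natExpo s := by
    have : (∑ i, s i • (fun j : (Fin k)ᵒᵈ => (Pi.single i 1 : Fin k → ℤ) (OrderDual.ofDual j))) =
        fun j : (Fin k)ᵒᵈ => (s (OrderDual.ofDual j) : ℤ) := by
      ext j
      simp [Finset.sum_apply, Pi.single_apply]
    exact this
  rw [polyToLaurent, MvPolynomial.coe_eval₂Hom, MvPolynomial.eval₂_monomial,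
    Finsupp.prod_fintype _ _ (by simp), h, h2, HahnSeries.C_apply, HahnSeries.single_mul_single]
  simp

theorem coeff_polyToLaurent {k : ℕ} (p : MvPolynomial (Fin k) ℚ) (s : Fin k →₀ ℕ) :
    (polyToLaurent k p).coeff (natExpo s) = p.coeff s := by
  induction p using MvPolynomial.induction_on' with
  | monomial t a =>
    rw [polyToLaurent_monomial, HahnSeries.coeff_single, MvPolynomial.coeff_monomial]
    simp [natExpo_injective.eq_iff, eq_comm]
  | add p q hp hq => rw [map_add, HahnSeries.coeff_add, MvPolynomial.coeff_add, hp, hq]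

theorem polyToLaurent_injective (k : ℕ) : Function.Injective (polyToLaurent k) := by
  intro p q h
  ext s
  rw [← coeff_polyToLaurent, h, coeff_polyToLaurent]

/-- The Laurent expansion of a rational function: the field embedding that sends `x_i` to the
monomial `x_i`. As the exponent of `x_j / x_i` is positive for `i < j`, it sends
`1 / (x_i + x_j)` to `x_i ^ (-1) - x_j * x_i ^ (-2) + x_j ^ 2 * x_i ^ (-3) - ⋯`. -/
noncomputable def expand (k : ℕ) : RatFun k →+* Laurent k :=
  IsFractionRing.lift (K := RatFun k) (L := Laurent k) (polyToLaurent_injective k)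

/-- `P` is the polynomial component and `Q` the antipolynomial component of `f`: `f = P + Q`,
`P` is a polynomial and every monomial of the expansion of `Q` contains a variable in a
negative power. -/
def IsDecomposition {k : ℕ} (f : RatFun k) (P : MvPolynomial (Fin k) ℚ) (Q : RatFun k) : Prop :=
  f = algebraMap _ (RatFun k) P + Q ∧
    ∀ c : Fin k → ℤ, (expand k Q).coeff (expo c) ≠ 0 → ∃ i, c i < 0

/-- The value of a function at a point is unique. -/
theorem HasValueAt.unique {k : ℕ} {f : RatFun k} {c : Fin k → ℕ} {y z : ℚ}
    (hy : HasValueAt f c y) (hz : HasValueAt f c z) : y = z := by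
  obtain ⟨p, hp, hpl⟩ := hy
  obtain ⟨q, hq, hql⟩ := hz
  have hd : denom k ≠ 0 := by
    refine Finset.prod_ne_zero_iff.2 fun r _ h => ?_
    have := congrArg (MvPolynomial.eval fun _ => (1 : ℚ)) h
    norm_num at this
  have hd' : algebraMap _ (RatFun k) (denom k) ≠ 0 := by
    simpa using hd
  have hpq : p = q := by
    apply IsFractionRing.injective (MvPolynomial (Fin k) ℚ) (RatFun k)
    exact (div_left_inj' hd').1 (hp.symm.trans hq)
  subst hpq
  exact_mod_cast tendsto_nhds_unique hpl hql

/-- The decomposition into polynomial and antipolynomial components is unique. -/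
theorem IsDecomposition.unique {k : ℕ} {f : RatFun k} {P P' : MvPolynomial (Fin k) ℚ}
    {Q Q' : RatFun k} (h : IsDecomposition f P Q) (h' : IsDecomposition f P' Q') :
    P = P' ∧ Q = Q' := by
  have key : ∀ {P : MvPolynomial (Fin k) ℚ} {Q : RatFun k}, IsDecomposition f P Q →
      ∀ s, P.coeff s = (expand k f).coeff (natExpo s) := by
    intro P Q hPQ s
    have h0 : (expand k Q).coeff (natExpo s) = 0 := by
      by_contra hne
      obtain ⟨i, hi⟩ := hPQ.2 _ hne
      exact absurd hi (by simp)
    have h1 : expand k (algebraMap _ (RatFun k) P) = polyToLaurent k P :=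
      IsFractionRing.lift_algebraMap (K := RatFun k) (polyToLaurent_injective k) P
    rw [hPQ.1, map_add, HahnSeries.coeff_add, h0, h1, coeff_polyToLaurent, add_zero]
  have hP : P = P' := by
    ext s
    rw [key h, key h']
  subst hP
  exact ⟨rfl, add_left_cancel (h.1.symm.trans h'.1)⟩

end StrictPaths

open StrictPaths

/-! ### Cancellative families of symmetric polynomials and division with remainder. -/

namespace StrictPaths
open Polynomial

/-! The function $g$ is the product of all $(x_i-x_j)/(x_i+x_j)$, $i<j$ (`altProd`), times a
symmetric polynomial $h$ with the cancellation property $h(a,-a,U)=h(U)$. For $\psi_v$ this follows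
by Lagrange interpolation: summing over the first index of the permutation gives a coefficient of a
remainder modulo $\prod(X-u)$, which makes sense in every $\mathbb Q$-algebra (`psiFam`,
`psi_eq_psiFam`).

The denominators are removed one variable at a time, starting with $x_1$. As a function of $x_i$,
the product of $h$ and the factors containing $x_i$ has a polynomial part and simple poles at
$x_i=-x_j$; by cancellation, the residues involve $h$ with both $x_i$ and $x_j$ removed
(`Fam.step_identity`, `Fam.alt_insert`). The polar terms contain the factor $2x_j/(x_i+x_j)$, and
all their monomials have a negative power of $x_i$. They belong to $Q[g]$, and what survives all the
divisions is $P[g]$ (`isAntipoly_sub_polyComp`).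

At a point $c$ of the simplex the polar terms tend to zero. If $c_j=0$, the factor $2x_j/(x_i+x_j)$
does. If $c_j>0$, the other factor tends by induction to a value of $g$ in fewer variables, at a
point with coordinate sum less than $n$, and such values vanish (`value_gFam_of_lt`). So $P[g]$ and
$g$ agree on the simplex (`IsCurve.tendsto_alt_iterate`, `eval_polyComp`).

As $P[g]$ has degree at most $n$ and vanishes at coordinate sums below $n$, Newton interpolation
determines it, and its coefficients in degree $n$ are its values divided by factorials
(`eq_sum_newton`, `coeff_eq_eval_div`). Hence the conjectural number of paths is the coefficient of
$x^u$ in the expansion of $g$ (`coeff_alt_gFam`). Passing from $n$ to $n+1$ multiplies $g$ by $\sum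
x_i-n$, so these coefficients obey the recursion of path counts by the last edge
(`pathFormula_succ`); the contributions from outside the graph vanish. The case $n=m$ is
`value_parts_self` and `value_parts_eq_zero`. -/

theorem mul_divModByMonic_mul_left {R : Type*} [CommRing R] {c d : R[X]} (hc : c.Monic)
    (hd : d.Monic) (p : R[X]) :
    (c * p) /ₘ (c * d) = p /ₘ d ∧ (c * p) %ₘ (c * d) = c * (p %ₘ d) := by
  nontriviality R
  refine div_modByMonic_unique _ _ (hc.mul hd) ⟨?_, ?_⟩
  · conv_rhs => rw [← modByMonic_add_div p d]
    ring
  · rw [hc.degree_mul_comm, hc.degree_mul, hc.degree_mul_comm, hc.degree_mul, add_comm,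
      add_comm d.degree]
    exact WithBot.add_lt_add_left (by simpa using hc.ne_zero) (degree_modByMonic_lt _ hd)

theorem ff_map {R S : Type} [CommRing R] [CommRing S] (f : R →+* S) (a : R) (n : ℕ) :
    f (ff a n) = ff (f a) n := by
  rw [ff, ff, ← descPochhammer_map f, eval_map, eval₂_hom]

/-- `∏ (X - u)` over the multiset `U`. -/
noncomputable def prodSub {R : Type} [CommRing R] (U : Multiset R) : R[X] :=
  (U.map fun u => X - C u).prod

/-- `∏ (X + u)` over the multiset `U`. -/
noncomputable def prodAdd {R : Type} [CommRing R] (U : Multiset R) : R[X] :=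
  (U.map fun u => X + C u).prod

theorem monic_prodSub {R : Type} [CommRing R] (U : Multiset R) : (prodSub U).Monic :=
  monic_multiset_prod_of_monic _ _ fun u _ => monic_X_sub_C u

theorem monic_prodAdd {R : Type} [CommRing R] (U : Multiset R) : (prodAdd U).Monic :=
  monic_multiset_prod_of_monic _ _ fun u _ => monic_X_add_C u

theorem prodSub_cons {R : Type} [CommRing R] (a : R) (U : Multiset R) :
    prodSub (a ::ₘ U) = (X - C a) * prodSub U := by
  simp [prodSub]

theorem prodAdd_cons {R : Type} [CommRing R] (a : R) (U : Multiset R) :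
    prodAdd (a ::ₘ U) = (X + C a) * prodAdd U := by
  simp [prodAdd]

theorem prodSub_map {R S : Type} [CommRing R] [CommRing S] (f : R →+* S) (U : Multiset R) :
    (prodSub U).map f = prodSub (U.map f) := by
  simp [prodSub, Polynomial.map_multiset_prod, Multiset.map_map]

theorem prodAdd_map {R S : Type} [CommRing R] [CommRing S] (f : R →+* S) (U : Multiset R) :
    (prodAdd U).map f = prodAdd (U.map f) := by
  simp [prodAdd, Polynomial.map_multiset_prod, Multiset.map_map]

theorem prodSub_pair {R : Type} [CommRing R] (a : R) (U : Multiset R) :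
    prodSub (a ::ₘ -a ::ₘ U) = ((X - C a) * (X + C a)) * prodSub U := by
  rw [prodSub_cons, prodSub_cons, C_neg]; ring

theorem prodAdd_pair {R : Type} [CommRing R] (a : R) (U : Multiset R) :
    prodAdd (a ::ₘ -a ::ₘ U) = ((X - C a) * (X + C a)) * prodAdd U := by
  rw [prodAdd_cons, prodAdd_cons, C_neg]; ring

theorem monic_pair {R : Type} [CommRing R] (a : R) : ((X - C a) * (X + C a) : R[X]).Monic :=
  (monic_X_sub_C a).mul (monic_X_add_C a)

theorem natDegree_prodSub {R : Type} [CommRing R] [Nontrivial R] (U : Multiset R) :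
    (prodSub U).natDegree = U.card := by
  simp [prodSub, natDegree_multiset_prod_X_sub_C_eq_card]

/-- The falling factorial `X (X - 1) ⋯ (X - m + 1)` divided by `X`. -/
noncomputable def redFF (R : Type) [CommRing R] (m : ℕ) : R[X] :=
  (descPochhammer R (m - 1)).comp (X - 1)

theorem redFF_map {R S : Type} [CommRing R] [CommRing S] (f : R →+* S) (m : ℕ) :
    (redFF R m).map f = redFF S m := by
  simp [redFF, Polynomial.map_comp, descPochhammer_map]

theorem mul_eval_redFF {R : Type} [CommRing R] {m : ℕ} (hm : 0 < m) (a : R) :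
    a * (redFF R m).eval a = ff a m := by
  obtain ⟨m, rfl⟩ := Nat.exists_eq_succ_of_ne_zero hm.ne'
  simp [redFF, ff, descPochhammer_succ_left]

/-- Families of functions of a list and a multiset of elements of a `ℚ`-algebra. -/
abbrev Fam : Type 1 := ∀ (R : Type) [CommRing R] [Algebra ℚ R], List R → Multiset R → R

/-- Compatibility of a family with ring homomorphisms. -/
def Fam.IsNatural (h : Fam) : Prop :=
  ∀ (R S : Type) [CommRing R] [Algebra ℚ R] [CommRing S] [Algebra ℚ S] (f : R →+* S)
    (T : List R) (U : Multiset R), f (h R T U) = h S (T.map f) (U.map f)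

/-- Invariance of a family under removal of a pair `a, -a`. -/
def Fam.IsCancellative (h : Fam) : Prop :=
  ∀ (R : Type) [CommRing R] [Algebra ℚ R] (T : List R) (a : R) (U : Multiset R),
    h R T (a ::ₘ -a ::ₘ U) = h R T U

/-- The functions `ψ` for a list of parts: `ψ_{m, ms}(U)` is the sum over `u ∈ U` of the values
`u (u - 1) ⋯ (u - m + 1) ψ_{ms}(U \ u) ∏ (u + w) / (u - w)`, computed as a coefficient of a residue
modulo `∏ (X - u)`, which makes sense in every `ℚ`-algebra. -/
noncomputable def psiFam : List ℕ → Fam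
  | [], _, _, _, _, _ => 1
  | m :: ms, R, _, _, _, U =>
    algebraMap ℚ R (1 / 2) *
      (X * ((redFF R m * psiFam ms R[X] [] (-X ::ₘ U.map C) * prodAdd U) %ₘ prodSub U)).coeff
        (Multiset.card U)

theorem psiFam_natural (ms : List ℕ) : (psiFam ms).IsNatural := by
  induction ms with
  | nil => intro R S _ _ _ _ f T U; simp [psiFam]
  | cons m ms ih =>
    intro R S _ _ _ _ f T U
    have h := ih R[X] S[X] (mapRingHom f) [] (-X ::ₘ U.map C)
    simp only [psiFam, map_mul, ← coeff_map, Multiset.card_map, Polynomial.map_mul, map_X,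
      map_modByMonic f (monic_prodSub U), redFF_map, prodAdd_map, prodSub_map,
      RingHom.map_rat_algebraMap]
    rw [← coe_mapRingHom, h]
    simp [Multiset.map_map]

/-- The pair multiplies both products by $X^2-a^2$, hence the remainder too. Its top coefficient
does not change, because the old remainder has degree less than `U.card`. -/
theorem psiFam_cancellative (ms : List ℕ) : (psiFam ms).IsCancellative := by
  induction ms with
  | nil => intro R _ _ T a U; simp [psiFam]
  | cons m ms ih =>
    intro R _ _ T a U
    rcases subsingleton_or_nontrivial R with hR | hR
    · exact Subsingleton.elim _ _
    simp only [psiFam]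
    congr 1
    rw [prodSub_pair, prodAdd_pair, Multiset.map_cons, Multiset.map_cons, C_neg,
      Multiset.cons_swap (-X) (C a), Multiset.cons_swap (-X) (-C a), ih]
    set N := psiFam ms R[X] [] (-X ::ₘ U.map C)
    rw [show redFF R m * N * ((X - C a) * (X + C a) * prodAdd U) =
      ((X - C a) * (X + C a)) * (redFF R m * N * prodAdd U) by ring,
      (mul_divModByMonic_mul_left (monic_pair a) (monic_prodSub U) _).2]
    set q := (redFF R m * N * prodAdd U) %ₘ prodSub U with hq
    have hdeg : q.coeff (U.card + 1) = 0 := by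
      refine coeff_eq_zero_of_degree_lt ((degree_modByMonic_lt _ (monic_prodSub U)).trans_le ?_)
      rw [degree_eq_natDegree (monic_prodSub U).ne_zero, natDegree_prodSub]
      exact_mod_cast Nat.le_succ _
    rw [Multiset.card_cons, Multiset.card_cons,
      show X * ((X - C a) * (X + C a) * q) = (X * q) * X ^ 2 - C (a ^ 2) * (X * q) by
        rw [C_pow]; ring, coeff_sub, coeff_C_mul, add_assoc, coeff_mul_X_pow, ← add_assoc,
        coeff_X_mul, hdeg]
    simp

/-- The polynomial part, in the variable `t`, of `∏ (t - u) / (t + u)` times the family `h`. -/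
noncomputable def Fam.step (h : Fam) : Fam
  | _, _, _, [], _ => 0
  | R, _, _, t :: T, U =>
    ((prodSub U * h R[X] (T.map C) (X ::ₘ U.map C)) /ₘ prodAdd U).eval t

theorem Fam.IsNatural.step {h : Fam} (hh : h.IsNatural) : h.step.IsNatural := by
  intro R S _ _ _ _ f T U
  cases T with
  | nil => simp [Fam.step]
  | cons t T =>
    have := hh R[X] S[X] (mapRingHom f) (T.map C) (X ::ₘ U.map C)
    simp only [Fam.step, List.map_cons]
    rw [← eval₂_hom, ← eval_map, map_divByMonic f (monic_prodAdd U), Polynomial.map_mul,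
      ← coe_mapRingHom, this]
    simp [Multiset.map_map, Function.comp_def, prodSub_map, prodAdd_map]

/-- Dividend and divisor acquire the same monic factor, so the quotient is unchanged. -/
theorem Fam.IsCancellative.step {h : Fam} (hh : h.IsCancellative) : h.step.IsCancellative := by
  intro R _ _ T a U
  cases T with
  | nil => simp [Fam.step]
  | cons t T =>
    simp only [Fam.step]
    rw [Multiset.map_cons, Multiset.map_cons, C_neg,
      Multiset.cons_swap X (C a), Multiset.cons_swap X (-C a), hh, prodSub_pair, prodAdd_pair, mul_assoc,
      (mul_divModByMonic_mul_left (monic_pair a) (monic_prodAdd U) _).1]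

theorem Fam.IsNatural.iterate {h : Fam} (hh : h.IsNatural) (n : ℕ) :
    (Fam.step^[n] h).IsNatural := by
  induction n with
  | zero => exact hh
  | succ n ih => rw [Function.iterate_succ_apply']; exact ih.step

theorem Fam.IsCancellative.iterate {h : Fam} (hh : h.IsCancellative) (n : ℕ) :
    (Fam.step^[n] h).IsCancellative := by
  induction n with
  | zero => exact hh
  | succ n ih => rw [Function.iterate_succ_apply']; exact ih.step

/-- The family of the functions `ψ · (∑ u - m) ⋯ (∑ u - n + 1)`. -/
noncomputable def gFam (ms : List ℕ) (m n : ℕ) : Fam := fun R _ _ _ U =>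
  psiFam ms R [] U * ff (U.sum - (m : R)) (n - m)

theorem gFam_natural (ms : List ℕ) (m n : ℕ) : (gFam ms m n).IsNatural := by
  intro R S _ _ _ _ f T U
  have := psiFam_natural ms R S f [] U
  simp only [gFam, map_mul, ff_map, this, map_sub, map_natCast, map_multiset_sum, List.map_nil]

theorem gFam_cancellative (ms : List ℕ) (m n : ℕ) : (gFam ms m n).IsCancellative := by
  intro R _ _ T a U
  simp only [gFam, psiFam_cancellative ms R [] a U]
  simp

end StrictPaths

/-! ### Partial fractions over a field. -/

namespace StrictPaths
open Polynomial

/-- `∏ (y_i - y_j) / (y_i + y_j)` over the pairs `i < j` in `S`. -/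
noncomputable def altProd {k : ℕ} {K : Type} [Field K] (y : Fin k → K) (S : Finset (Fin k)) : K :=
  ∏ i ∈ S, ∏ j ∈ S, if i < j then (y i - y j) / (y i + y j) else 1

/-- The sign `(-1) ^ #{j ∈ S | j < i}`. -/
def posSign {k : ℕ} (S : Finset (Fin k)) (i : Fin k) : ℤ :=
  ∏ j ∈ S, if j < i then -1 else 1

theorem altProd_univ {k : ℕ} {K : Type} [Field K] (y : Fin k → K) :
    altProd y Finset.univ = ∏ p ∈ pairs k, (y p.1 - y p.2) / (y p.1 + y p.2) := by
  rw [pairs, Finset.prod_filter, Fintype.prod_prod_type, altProd]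

theorem altProd_empty {k : ℕ} {K : Type} [Field K] (y : Fin k → K) : altProd y ∅ = 1 := by
  simp [altProd]

theorem altProd_insert {k : ℕ} {K : Type} [Field K] (y : Fin k → K) {S : Finset (Fin k)}
    {i : Fin k} (hi : i ∉ S) :
    altProd y (insert i S) =
      posSign S i * (∏ j ∈ S, (y i - y j) / (y i + y j)) * altProd y S := by
  have h : (posSign S i : K) * ∏ j ∈ S, (y i - y j) / (y i + y j) =
      (∏ j ∈ S, if i < j then (y i - y j) / (y i + y j) else 1) *
        ∏ j ∈ S, if j < i then (y j - y i) / (y j + y i) else 1 := by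
    rw [posSign, Int.cast_prod, ← Finset.prod_mul_distrib, ← Finset.prod_mul_distrib]
    refine Finset.prod_congr rfl fun j hj => ?_
    rcases lt_trichotomy i j with hij | rfl | hij
    · simp [hij, hij.not_gt]
    · exact absurd hj hi
    · simp only [hij, hij.not_gt, if_true, if_false, Int.cast_neg, Int.cast_one]
      rw [add_comm (y j), ← neg_sub (y i)]
      ring
  rw [h, altProd, Finset.prod_insert hi, Finset.prod_insert hi]
  simp only [Finset.prod_insert hi, Finset.prod_mul_distrib, lt_irrefl, if_false, one_mul]
  rw [altProd]
  ring

theorem posSign_erase {k : ℕ} (S : Finset (Fin k)) (i : Fin k) :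
    posSign (S.erase i) i = posSign S i := by
  rw [posSign, posSign]
  exact Finset.prod_erase _ (by simp)

theorem posSign_eq_one {k : ℕ} {S : Finset (Fin k)} {i : Fin k} (h : ∀ j ∈ S, i ≤ j) :
    posSign S i = 1 :=
  Finset.prod_eq_one fun j hj => if_neg (h j hj).not_gt

theorem altProd_erase {k : ℕ} {K : Type} [Field K] (y : Fin k → K) {S : Finset (Fin k)}
    {i : Fin k} (hi : i ∈ S) :
    altProd y S =
      posSign S i * (∏ j ∈ S.erase i, (y i - y j) / (y i + y j)) * altProd y (S.erase i) := by
  conv_lhs => rw [← Finset.insert_erase hi]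
  rw [altProd_insert y (Finset.notMem_erase i S), posSign_erase]

theorem altProd_mul_prod {k : ℕ} {K : Type} [Field K] {y : Fin k → K} {S : Finset (Fin k)}
    (hy : Set.InjOn y S) (hy' : ∀ i ∈ S, ∀ j ∈ S, i ≠ j → y i + y j ≠ 0) {i : Fin k}
    (hi : i ∈ S) :
    altProd y S * ∏ j ∈ S.erase i, (y i + y j) / (y i - y j) =
      posSign S i * altProd y (S.erase i) := by
  have : (∏ j ∈ S.erase i, (y i - y j) / (y i + y j)) *
      ∏ j ∈ S.erase i, (y i + y j) / (y i - y j) = 1 := by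
    rw [← Finset.prod_mul_distrib]
    refine Finset.prod_eq_one fun j hj => ?_
    obtain ⟨hji, hj⟩ := Finset.mem_erase.1 hj
    have h1 := hy' i hi j hj hji.symm
    have h2 : y i - y j ≠ 0 := sub_ne_zero.2 fun h => hji (hy hi hj h).symm
    field_simp
  rw [altProd_erase y hi]
  linear_combination (posSign S i : K) * altProd y (S.erase i) * this

theorem val_map_eq_cons {k : ℕ} {K : Type} (y : Fin k → K) {S : Finset (Fin k)} {i : Fin k}
    (hi : i ∈ S) : S.val.map y = y i ::ₘ (S.erase i).val.map y := by
  conv_lhs => rw [← Finset.insert_erase hi]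
  rw [Finset.insert_val_of_notMem (Finset.notMem_erase i S), Multiset.map_cons]

theorem prodSub_val_map {k : ℕ} {K : Type} [CommRing K] (y : Fin k → K) (S : Finset (Fin k)) :
    prodSub (S.val.map y) = Lagrange.nodal S y := by
  rw [prodSub, Multiset.map_map]; rfl

theorem prodAdd_val_map {k : ℕ} {K : Type} [CommRing K] (y : Fin k → K) (S : Finset (Fin k)) :
    prodAdd (S.val.map y) = Lagrange.nodal S (fun i => -y i) := by
  rw [prodAdd, Multiset.map_map, Lagrange.nodal_eq]
  simp only [C_neg, sub_neg_eq_add]; rfl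

/-- Evaluation at `a` is a ring homomorphism that undoes `C`, so naturality applies. -/
theorem eval_natural {K : Type} [Field K] [Algebra ℚ K] {h : Fam} (hh : h.IsNatural) (T : List K)
    (a : K) (f : K[X]) (U : Multiset K) :
    (h K[X] (T.map C) (f ::ₘ U.map C)).eval a = h K T (f.eval a ::ₘ U) := by
  have := hh K[X] K (evalRingHom a) (T.map C) (f ::ₘ U.map C)
  simpa [Multiset.map_map, Function.comp_def] using this

/-- Lagrange interpolation expresses the top coefficient of the remainder through its values at the
nodes. At the node `y i` the argument $-X$ cancels `y i` itself. -/
theorem psiFam_cons_eq_sum {k : ℕ} {K : Type} [Field K] [Algebra ℚ K] {y : Fin k → K}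
    {S : Finset (Fin k)} (hy : Set.InjOn y S) {m : ℕ} (hm : 0 < m) (ms : List ℕ) (T : List K) :
    psiFam (m :: ms) K T (S.val.map y) = ∑ i ∈ S, ff (y i) m *
      (∏ j ∈ S.erase i, (y i + y j) / (y i - y j)) *
        psiFam ms K [] ((S.erase i).val.map y) := by
  simp only [psiFam]
  set U := S.val.map y with hU
  set M := redFF K m * psiFam ms K[X] [] (-X ::ₘ U.map C) * prodAdd U with hM
  have hc : Multiset.card U = S.card := by simp [hU]
  rcases S.eq_empty_or_nonempty with rfl | hS
  · simp [hU]
  obtain ⟨c, hcc⟩ := Nat.exists_eq_succ_of_ne_zero hS.card_ne_zero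
  have hdeg : (M %ₘ prodSub U).degree < S.card := by
    refine (degree_modByMonic_lt _ (monic_prodSub U)).trans_le ?_
    rw [hU, prodSub_val_map, Lagrange.degree_nodal]
  have hcs := Lagrange.coeff_eq_sum hy hdeg
  rw [hc, hcc, Nat.succ_eq_add_one, coeff_X_mul]
  rw [hcc, Nat.succ_eq_add_one, Nat.add_sub_cancel] at hcs
  rw [hcs, Finset.mul_sum]
  refine Finset.sum_congr rfl fun i hi => ?_
  have h0 : (prodSub U).eval (y i) = 0 := by
    rw [hU, prodSub_val_map, Lagrange.eval_nodal_at_node hi]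
  have h1 : (M %ₘ prodSub U).eval (y i) = M.eval (y i) := by
    conv_rhs => rw [← modByMonic_add_div M (prodSub U)]
    rw [eval_add, eval_mul, h0]; ring
  have h2 : (psiFam ms K[X] [] (-X ::ₘ U.map C)).eval (y i) =
      psiFam ms K [] ((S.erase i).val.map y) := by
    have := eval_natural (psiFam_natural ms) [] (y i) (-X) U
    rw [List.map_nil] at this
    rw [this, hU, val_map_eq_cons y hi, Multiset.cons_swap, eval_neg, eval_X,
      psiFam_cancellative]
  -- The factor of `i` itself is `2 * y i`: the 2 is cancelled by the constant 1/2 in `psiFam`, and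
  -- `y i` completes `redFF` to the falling factorial.
  have h3 : (prodAdd U).eval (y i) = 2 * y i * ∏ j ∈ S.erase i, (y i + y j) := by
    rw [hU, prodAdd_val_map, Lagrange.eval_nodal, ← Finset.mul_prod_erase _ _ hi]
    simp only [sub_neg_eq_add]
    ring
  have h4 : algebraMap ℚ K (1 / 2) * 2 = 1 := by
    rw [← map_ofNat (algebraMap ℚ K) 2, ← map_mul]; norm_num
  rw [h1, hM, eval_mul, eval_mul, h2, h3, ← mul_eval_redFF hm, Finset.prod_div_distrib]
  linear_combination (y i * (redFF K m).eval (y i) * psiFam ms K [] ((S.erase i).val.map y) *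
    (∏ j ∈ S.erase i, (y i + y j)) / ∏ j ∈ S.erase i, (y i - y j)) * h4

/-- Partial fractions in `t`: the quotient is the polynomial part, and the remainder is interpolated
at its nodes `-y j`, where the argument `-y j` of `h` cancels `y j`. -/
theorem Fam.step_identity {k : ℕ} {K : Type} [Field K] [Algebra ℚ K] {y : Fin k → K}
    {S : Finset (Fin k)} (hy : Set.InjOn y S) {h : Fam} (hh : h.IsNatural)
    (hc : h.IsCancellative) (T : List K) {t : K} (ht : ∀ j ∈ S, t + y j ≠ 0) :
    (∏ j ∈ S, (t - y j) / (t + y j)) * h K T (t ::ₘ S.val.map y) =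
      h.step K (t :: T) (S.val.map y) - ∑ j ∈ S, 2 * y j / (t + y j) *
        (∏ l ∈ S.erase j, (y j + y l) / (y j - y l)) * h K T ((S.erase j).val.map y) := by
  simp only [Fam.step]
  set U := S.val.map y with hU
  set N := h K[X] (T.map C) (X ::ₘ U.map C) with hN
  have hy' : Set.InjOn (fun i => -y i) S := fun i hi j hj hij => hy hi hj (neg_injective hij)
  have hdeg : ((prodSub U * N) %ₘ prodAdd U).degree < S.card := by
    refine (degree_modByMonic_lt _ (monic_prodAdd U)).trans_le ?_
    rw [hU, prodAdd_val_map, Lagrange.degree_nodal]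
  have hD : (prodAdd U).eval t = ∏ j ∈ S, (t + y j) := by
    rw [hU, prodAdd_val_map, Lagrange.eval_nodal]; simp
  have hD0 : (∏ j ∈ S, (t + y j)) ≠ 0 := Finset.prod_ne_zero_iff.2 ht
  have hF : ∀ a, (prodSub U).eval a = ∏ j ∈ S, (a - y j) := fun a => by
    rw [hU, prodSub_val_map, Lagrange.eval_nodal]
  have hNt : N.eval t = h K T (t ::ₘ U) := by
    rw [hN, eval_natural hh, eval_X]
  have hr : ∀ j ∈ S, ((prodSub U * N) %ₘ prodAdd U).eval (-y j) =
      (∏ l ∈ S, (-y j - y l)) * h K T ((S.erase j).val.map y) := fun j hj => by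
    have h0 : (prodAdd U).eval (-y j) = 0 := by
      rw [hU, prodAdd_val_map, Lagrange.eval_nodal_at_node (v := fun i => -y i) hj]
    have h1 : ((prodSub U * N) %ₘ prodAdd U).eval (-y j) = (prodSub U * N).eval (-y j) := by
      conv_rhs => rw [← modByMonic_add_div (prodSub U * N) (prodAdd U)]
      rw [eval_add, eval_mul, h0]; ring
    rw [h1, eval_mul, hF, hN, eval_natural hh, eval_X, hU, val_map_eq_cons y hj,
      Multiset.cons_swap, hc]
  have key := congrArg (eval t) (modByMonic_add_div (prodSub U * N) (prodAdd U))
  rw [eval_add, eval_mul, eval_mul, hD, hF, hNt,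
    Lagrange.eq_interpolate hy' hdeg,
    Lagrange.eval_interpolate_not_at_node _ (fun j hj => by
      intro h; exact ht j hj (by rw [h]; ring)), Lagrange.eval_nodal] at key
  simp only [sub_neg_eq_add] at key
  rw [Finset.prod_div_distrib, div_mul_eq_mul_div, ← key, add_div, mul_div_cancel_left₀ _ hD0,
    mul_div_cancel_left₀ _ hD0, add_comm, sub_eq_add_neg, ← Finset.sum_neg_distrib]
  congr 1
  refine Finset.sum_congr rfl fun j hj => ?_
  -- The factor with `l = j` is `-y j - y j`; it yields the numerator `2 * y j` and the minus sign.
  rw [hr j hj, Lagrange.nodalWeight, ← Finset.mul_prod_erase S _ hj,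
    show (∏ l ∈ S.erase j, (y j + y l) / (y j - y l)) =
      (∏ l ∈ S.erase j, (-y j - -y l)⁻¹) * ∏ l ∈ S.erase j, (-y j - y l) by
        rw [← Finset.prod_mul_distrib]
        refine Finset.prod_congr rfl fun l _ => ?_
        rw [show -y j - -y l = -(y j - y l) by ring, show -y j - y l = -(y j + y l) by ring,
          inv_neg, neg_mul_neg, mul_comm, div_eq_mul_inv]]
  rw [div_eq_mul_inv]
  ring

/-- The product of `altProd` with the value of a family at the elements of `S`. -/
noncomputable def Fam.alt (h : Fam) {k : ℕ} {K : Type} [Field K] [Algebra ℚ K] (y : Fin k → K)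
    (T : List (Fin k)) (S : Finset (Fin k)) : K :=
  altProd y S * h K (T.map y) (S.val.map y)

theorem alt_psiFam_cons {k : ℕ} {K : Type} [Field K] [Algebra ℚ K] {y : Fin k → K}
    {S : Finset (Fin k)} (hy : Set.InjOn y S)
    (hy' : ∀ i ∈ S, ∀ j ∈ S, i ≠ j → y i + y j ≠ 0) {m : ℕ} (hm : 0 < m) (ms : List ℕ) :
    (psiFam (m :: ms)).alt y [] S =
      ∑ i ∈ S, posSign S i * ff (y i) m * (psiFam ms).alt y [] (S.erase i) := by
  rw [Fam.alt, psiFam_cons_eq_sum hy hm, Finset.mul_sum]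
  refine Finset.sum_congr rfl fun i hi => ?_
  rw [Fam.alt, List.map_nil]
  linear_combination ff (y i) m * psiFam ms K [] ((S.erase i).val.map y) *
    altProd_mul_prod hy hy' hi

/-- This is `Fam.step_identity` multiplied by `altProd y S`, which absorbs the quotients
$(y_j+y_l)/(y_j-y_l)$ up to sign; `i` contributes no sign, being the least index. -/
theorem Fam.alt_insert {k : ℕ} {K : Type} [Field K] [Algebra ℚ K] {y : Fin k → K}
    {S : Finset (Fin k)} {i : Fin k} (hi : ∀ j ∈ S, i < j) (hy : Set.InjOn y S)
    (hy' : ∀ i j, i ≠ j → y i + y j ≠ 0) {h : Fam} (hh : h.IsNatural)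
    (hc : h.IsCancellative) (T : List (Fin k)) :
    h.alt y T (insert i S) = h.step.alt y (i :: T) S -
      ∑ j ∈ S, posSign S j * (2 * y j / (y i + y j)) * h.alt y T (S.erase j) := by
  have hiS : i ∉ S := fun h => (hi i h).false
  have key := Fam.step_identity hy hh hc (T.map y) (t := y i)
    (fun j hj => hy' i j (hi j hj).ne)
  simp only [Fam.alt]
  rw [altProd_insert y hiS, posSign_eq_one fun j hj => (hi j hj).le,
    Finset.insert_val_of_notMem hiS, Multiset.map_cons, Int.cast_one, one_mul,
    mul_comm (Finset.prod _ _), mul_assoc, key, mul_sub, Finset.mul_sum, List.map_cons]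
  congr 1
  refine Finset.sum_congr rfl fun j hj => ?_
  linear_combination 2 * y j / (y i + y j) * h K (T.map y) ((S.erase j).val.map y) *
    altProd_mul_prod hy (fun i _ j _ => hy' i j) hj

end StrictPaths

/-! ### The symmetrization formula for ψ. -/

namespace StrictPaths
open Polynomial

/-- The embedding of `Fin k` into `Fin (k + 1)` whose image is the complement of `p`. -/
def swapEmb {k : ℕ} (p : Fin (k + 1)) : Fin k ↪ Fin (k + 1) :=
  (Fin.succEmb k).trans (Equiv.swap 0 p).toEmbedding

theorem map_swapEmb {k : ℕ} (p : Fin (k + 1)) :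
    Finset.univ.map (swapEmb p) = Finset.univ.erase p := by
  ext a
  simp only [Finset.mem_map, Finset.mem_univ, true_and, Finset.mem_erase, and_true]
  constructor
  · rintro ⟨j, rfl⟩ h
    have := congrArg (Equiv.swap 0 p) h
    simp [swapEmb] at this
  · intro h
    obtain ⟨j, hj⟩ := Fin.exists_succ_eq.2 (show Equiv.swap 0 p a ≠ 0 from fun h' => h (by
      have := congrArg (Equiv.swap 0 p) h'
      simpa using this))
    exact ⟨j, by simp [swapEmb, hj]⟩

/-- Fixing the image `p` of the index 0 leaves a sum of the same form over the complement of `p`,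
which matches the recursion of `psiFam`. The factorial counts the permutations left when no parts
remain. -/
theorem sum_perm_eq_psiFam {K : Type} [Field K] [Algebra ℚ K] (l : ℕ) :
    ∀ (k : ℕ), l ≤ k → ∀ (v : Fin k → ℕ), (∀ i : Fin k, (i : ℕ) < l → 0 < v i) →
    ∀ (y : Fin k → K), Function.Injective y →
    ∑ π : Equiv.Perm (Fin k), (∏ i : Fin k, if (i : ℕ) < l then ff (y (π i)) (v i) else 1) *
      (∏ i : Fin k, ∏ j : Fin k, if i < j ∧ (i : ℕ) < l then
        (y (π i) + y (π j)) / (y (π i) - y (π j)) else 1) =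
    (k - l).factorial * psiFam ((List.ofFn v).take l) K [] (Finset.univ.val.map y) := by
  induction l with
  | zero =>
    intro k _ v _ y _
    simp [psiFam, Fintype.card_perm]
  | succ l ih =>
    intro k hk v hv y hy
    obtain ⟨k, rfl⟩ := Nat.exists_eq_succ_of_ne_zero (by omega : k ≠ 0)
    rw [← Equiv.sum_comp Equiv.Perm.decomposeFin.symm, Fintype.sum_prod_type]
    rw [List.ofFn_succ, List.take_succ_cons,
      psiFam_cons_eq_sum hy.injOn (hv 0 (by simp)), Finset.mul_sum]
    refine Finset.sum_congr rfl fun p _ => ?_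
    have hih := ih k (by omega) (fun i => v i.succ) (fun i hi => hv _ (by simpa using hi))
      (fun j => y (swapEmb p j)) (hy.comp (swapEmb p).injective)
    have h1 : (Finset.univ.erase p).val.map y = Finset.univ.val.map fun j => y (swapEmb p j) := by
      rw [← map_swapEmb, Finset.map_val, Multiset.map_map]; rfl
    have h2 : ∏ j ∈ Finset.univ.erase p, (y p + y j) / (y p - y j) =
        ∏ j, (y p + y (swapEmb p j)) / (y p - y (swapEmb p j)) := by
      rw [← map_swapEmb, Finset.prod_map]
    rw [h1, h2, Nat.succ_sub_succ, mul_left_comm, ← hih, Finset.mul_sum]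
    refine Finset.sum_congr rfl fun e _ => ?_
    have h3 : ∀ j : Fin k, Equiv.swap 0 p (e j).succ = swapEmb p (e j) := fun j => rfl
    rw [← Equiv.prod_comp e fun j => (y p + y (swapEmb p j)) / (y p - y (swapEmb p j))]
    simp only [Fin.prod_univ_succ, Equiv.Perm.decomposeFin_symm_apply_zero,
      Equiv.Perm.decomposeFin_symm_apply_succ, h3]
    simp only [Fin.val_zero, Nat.zero_lt_succ, if_true, lt_irrefl, false_and, if_false,
      Fin.succ_pos, true_and, one_mul, Fin.val_succ, Nat.add_lt_add_iff_right,
      Fin.not_lt_zero, Fin.succ_lt_succ_iff]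
    ring

/-- The list of the non-zero parts of `v`. -/
def parts {k : ℕ} (v : Fin k → ℕ) : List ℕ := (List.ofFn v).take (len v)

theorem len_le {k : ℕ} (v : Fin k → ℕ) : len v ≤ k :=
  (Finset.card_filter_le _ _).trans (by simp)

theorem lt_len_iff {k : ℕ} {v : Fin k → ℕ} (hv : Antitone v) (i : Fin k) :
    (i : ℕ) < len v ↔ v i ≠ 0 := by
  have hsub : ∀ i, v i ≠ 0 → Finset.Iic i ⊆ Finset.univ.filter fun i => v i ≠ 0 := by
    intro i hi j hj
    have := hv (Finset.mem_Iic.1 hj)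
    simp only [Finset.mem_filter, Finset.mem_univ, true_and]
    omega
  constructor
  · intro hi h0
    have : (Finset.univ.filter fun i => v i ≠ 0) ⊆ Finset.Iio i := fun j hj => by
      simp only [Finset.mem_filter, Finset.mem_univ, true_and] at hj
      refine Finset.mem_Iio.2 (lt_of_not_ge fun hij => ?_)
      have := hv hij
      omega
    have := Finset.card_le_card this
    rw [Fin.card_Iio] at this
    exact absurd hi (not_lt.2 this)
  · intro hi
    have := Finset.card_le_card (hsub i hi)
    rw [Fin.card_Iic] at this
    exact this

theorem x_injective {k : ℕ} : Function.Injective (x (k := k)) :=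
  (IsFractionRing.injective _ _).comp (MvPolynomial.X_injective)

theorem psi_eq_psiFam {k : ℕ} {v : Fin k → ℕ} (hv : Antitone v) :
    psi v = psiFam (parts v) (RatFun k) [] (Finset.univ.val.map x) := by
  have h := sum_perm_eq_psiFam (K := RatFun k) (len v) k (len_le v) v
    (fun i hi => Nat.pos_of_ne_zero ((lt_len_iff hv i).1 hi)) x x_injective
  have h0 : ((k - len v).factorial : RatFun k) ≠ 0 := by exact_mod_cast Nat.factorial_ne_zero _
  rw [psi, inv_mul_eq_iff_eq_mul₀ h0, parts, ← h]
  refine Finset.sum_congr rfl fun π _ => ?_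
  rw [Finset.prod_filter, pairs, Finset.filter_filter, Finset.prod_filter, Fintype.prod_prod_type]

theorem map_val_map {k : ℕ} {R S : Type} (f : R → S) (y : Fin k → R) (s : Finset (Fin k)) :
    (s.val.map y).map f = s.val.map (fun i => f (y i)) := by
  rw [Multiset.map_map]; rfl

/-- The function `ψ_v` as a polynomial. -/
noncomputable def psiPoly (k : ℕ) (ms : List ℕ) : MvPolynomial (Fin k) ℚ :=
  psiFam ms _ [] (Finset.univ.val.map MvPolynomial.X)

theorem algebraMap_psiPoly {k : ℕ} {v : Fin k → ℕ} (hv : Antitone v) :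
    algebraMap _ (RatFun k) (psiPoly k (parts v)) = psi v := by
  rw [psi_eq_psiFam hv, psiPoly, psiFam_natural, map_val_map]; rfl

theorem phi_eq_alt {k : ℕ} {v : Fin k → ℕ} (hv : Antitone v) :
    phi v = (psiFam (parts v)).alt x [] Finset.univ := by
  rw [phi, psi_eq_psiFam hv, Fam.alt, altProd_univ, List.map_nil]

theorem sum_parts {k : ℕ} {v : Fin k → ℕ} (hv : Antitone v) : (parts v).sum = ∑ i, v i := by
  have h : ((List.ofFn v).drop (len v)).sum = 0 := by
    refine List.sum_eq_zero fun a ha => ?_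
    obtain ⟨j, hj, rfl⟩ := List.mem_iff_getElem.1 ha
    rw [List.length_drop, List.length_ofFn] at hj
    have hl : ¬ (((⟨len v + j, by omega⟩ : Fin k) : ℕ) < len v) := by simp
    rw [lt_len_iff hv, not_not] at hl
    simpa using hl
  have := List.sum_take_add_sum_drop (List.ofFn v) (len v)
  rw [h, add_zero, List.sum_ofFn] at this
  exact this

theorem pos_of_mem_parts {k : ℕ} {v : Fin k → ℕ} (hv : Antitone v) {a : ℕ} (ha : a ∈ parts v) :
    0 < a := by
  obtain ⟨j, hj, rfl⟩ := List.mem_iff_getElem.1 ha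
  simp only [parts, List.length_take, List.length_ofFn, lt_inf_iff] at hj
  have := (lt_len_iff hv ⟨j, hj.2⟩).1 hj.1
  simpa [parts] using Nat.pos_of_ne_zero this

end StrictPaths

/-! ### Limits along curves and vanishing of values. -/

namespace StrictPaths
open Polynomial Filter Topology

/-- A curve of points with positive coordinates that tends to `c` and has vanishing limits of the
quotients `y_j / y_i`, where `i < j` and `c_i = c_j = 0`. -/
structure IsCurve {k : ℕ} (c : Fin k → ℕ) (y : ℝ → Fin k → ℝ) : Prop where
  tendsto : ∀ i, Tendsto (fun t => y t i) (𝓝[>] 0) (𝓝 (c i : ℝ))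
  pos : ∀ᶠ t in 𝓝[>] 0, ∀ i, 0 < y t i
  small : ∀ i j, i < j → c i = 0 → c j = 0 → Tendsto (fun t => y t j / y t i) (𝓝[>] 0) (𝓝 0)

theorem tendsto_pow_nhdsGT_zero {n : ℕ} (hn : n ≠ 0) :
    Tendsto (fun t : ℝ => t ^ n) (𝓝[>] 0) (𝓝 0) :=
  tendsto_nhdsWithin_of_tendsto_nhds ((continuous_pow n).tendsto' 0 0 (zero_pow hn))

theorem tendsto_pow_div_pow {a b : ℕ} (hab : a < b) :
    Tendsto (fun t : ℝ => t ^ b / t ^ a) (𝓝[>] 0) (𝓝 0) := by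
  refine (tendsto_pow_nhdsGT_zero (Nat.sub_ne_zero_of_lt hab)).congr' ?_
  filter_upwards [self_mem_nhdsWithin] with t ht
  rw [pow_sub₀ t (ne_of_gt ht) hab.le, div_eq_mul_inv]

theorem isCurve_perturb {k : ℕ} (c : Fin k → ℕ) : IsCurve c (perturb c) where
  tendsto i := by
    by_cases h : c i = 0
    · simp only [perturb, h, if_true, Nat.cast_zero]
      refine tendsto_pow_nhdsGT_zero (Finset.card_ne_zero_of_mem (a := i) ?_)
      simp [h]
    · simp [perturb, h]
  pos := by
    filter_upwards [self_mem_nhdsWithin] with t ht i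
    by_cases h : c i = 0
    · simpa [perturb, h] using pow_pos ht _
    · simpa [perturb, h] using Nat.pos_of_ne_zero h
  small i j hij hi hj := by
    simp only [perturb, hi, hj, if_true]
    refine tendsto_pow_div_pow (Finset.card_lt_card ?_)
    refine Finset.ssubset_iff_of_subset ?_ |>.2 ⟨j, ?_, ?_⟩
    · intro a
      simp only [Finset.mem_filter, Finset.mem_univ, true_and]
      exact fun h => ⟨h.1.trans hij.le, h.2⟩
    · simp [hj]
    · simp [hij]

/-- A curve through `c` with pairwise different coordinates. -/
noncomputable def genericCurve {k : ℕ} (c : Fin k → ℕ) (t : ℝ) (i : Fin k) : ℝ :=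
  c i + t ^ ((i : ℕ) + 1)

theorem isCurve_genericCurve {k : ℕ} (c : Fin k → ℕ) : IsCurve c (genericCurve c) where
  tendsto i := by
    simpa [genericCurve] using
      (tendsto_const_nhds (x := (c i : ℝ))).add (tendsto_pow_nhdsGT_zero (Nat.succ_ne_zero (i : ℕ)))
  pos := by
    filter_upwards [self_mem_nhdsWithin] with t ht i
    exact add_pos_of_nonneg_of_pos (Nat.cast_nonneg _) (pow_pos ht _)
  small i j hij hi hj := by
    simp only [genericCurve, hi, hj, Nat.cast_zero, zero_add]
    exact tendsto_pow_div_pow (Nat.succ_lt_succ hij)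

theorem genericCurve_injective {k : ℕ} (c : Fin k → ℕ) :
    ∀ᶠ t in 𝓝[>] (0 : ℝ), Function.Injective (genericCurve c t) := by
  filter_upwards [Ioo_mem_nhdsGT (zero_lt_one (α := ℝ))] with t ht i j hij
  simp only [genericCurve] at hij
  have h0 : ∀ n : ℕ, 0 < t ^ (n + 1) ∧ t ^ (n + 1) < 1 := fun n =>
    ⟨pow_pos ht.1 _, pow_lt_one₀ ht.1.le ht.2 (Nat.succ_ne_zero n)⟩
  have hi := h0 i
  have hj := h0 j
  have hc : c i = c j := by
    have h1 : (c i : ℝ) < c j + 1 := by linarith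
    have h2 : (c j : ℝ) < c i + 1 := by linarith
    norm_cast at h1 h2
    omega
  rw [hc, add_right_inj] at hij
  have := pow_right_injective₀ ht.1 ht.2.ne hij
  exact Fin.ext (by omega)

/-- The limit of `(a - b) / (a + b)` at a point with non-negative integer coordinates. -/
def ratio (a b : ℕ) : ℚ := if a = 0 ∧ b = 0 then 1 else ((a : ℚ) - b) / (a + b)

/-- This kills the polar terms of `Fam.alt_insert` whose index `j` has a vanishing coordinate. -/
theorem IsCurve.tendsto_coeff {k : ℕ} {c : Fin k → ℕ} {y : ℝ → Fin k → ℝ} (hy : IsCurve c y)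
    {i j : Fin k} (hij : i < j) (h : c j = 0) :
    Tendsto (fun t => 2 * y t j / (y t i + y t j)) (𝓝[>] 0) (𝓝 0) := by
  by_cases hi : c i = 0
  · have := hy.small i j hij hi h
    have h2 : Tendsto (fun t => 2 * (y t j / y t i) / (1 + y t j / y t i)) (𝓝[>] 0)
        (𝓝 (2 * 0 / (1 + 0))) :=
      (this.const_mul 2).div (this.const_add 1) (by norm_num)
    rw [mul_zero, zero_div] at h2
    refine h2.congr' ?_
    filter_upwards [hy.pos] with t ht
    have := ht i
    have := ht j
    field_simp
  · have h2 := ((hy.tendsto j).const_mul 2).div ((hy.tendsto i).add (hy.tendsto j)) (by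
      rw [h, Nat.cast_zero, add_zero]; exact_mod_cast hi)
    simpa [h, Pi.div_def] using h2

theorem IsCurve.tendsto_ratio {k : ℕ} {c : Fin k → ℕ} {y : ℝ → Fin k → ℝ} (hy : IsCurve c y)
    {i j : Fin k} (hij : i < j) :
    Tendsto (fun t => (y t i - y t j) / (y t i + y t j)) (𝓝[>] 0) (𝓝 (ratio (c i) (c j) : ℝ)) := by
  by_cases h : c i = 0 ∧ c j = 0
  -- The ratio equals $1-2y_j/(y_i+y_j)$.
  · have h2 := (hy.tendsto_coeff hij h.2).const_sub 1
    rw [ratio, if_pos h]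
    simp only [sub_zero, Rat.cast_one] at h2 ⊢
    refine h2.congr' ?_
    filter_upwards [hy.pos] with t ht
    have := ht i
    have := ht j
    field_simp
    ring
  · have h2 := ((hy.tendsto i).sub (hy.tendsto j)).div ((hy.tendsto i).add (hy.tendsto j)) (by
      norm_cast
      omega)
    rw [ratio, if_neg h]
    push_cast
    exact h2

/-- The limit of `altProd`. -/
def altVal {k : ℕ} (c : Fin k → ℕ) (S : Finset (Fin k)) : ℚ :=
  ∏ i ∈ S, ∏ j ∈ S, if i < j then ratio (c i) (c j) else 1

theorem IsCurve.tendsto_altProd {k : ℕ} {c : Fin k → ℕ} {y : ℝ → Fin k → ℝ} (hy : IsCurve c y)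
    (S : Finset (Fin k)) :
    Tendsto (fun t => altProd (y t) S) (𝓝[>] 0) (𝓝 (altVal c S : ℝ)) := by
  simp only [altProd, altVal, Rat.cast_prod]
  refine tendsto_finsetProd _ fun i _ => tendsto_finsetProd _ fun j _ => ?_
  by_cases hij : i < j
  · simpa only [hij, if_true] using hy.tendsto_ratio hij
  · simp [hij]

theorem Fam.IsNatural.eval {h : Fam} (hh : h.IsNatural) {k : ℕ} {R S : Type} [CommRing R]
    [Algebra ℚ R] [CommRing S] [Algebra ℚ S] (f : R →+* S) (y : Fin k → R) (T : List (Fin k))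
    (U : Finset (Fin k)) :
    f (h R (T.map y) (U.val.map y)) = h S (T.map fun i => f (y i)) (U.val.map fun i => f (y i)) := by
  rw [hh, map_val_map, List.map_map]; rfl

theorem Fam.IsNatural.aeval {h : Fam} (hh : h.IsNatural) {k : ℕ} {R : Type} [CommRing R]
    [Algebra ℚ R] (y : Fin k → R) (T : List (Fin k)) (U : Finset (Fin k)) :
    MvPolynomial.aeval y
      (h (MvPolynomial (Fin k) ℚ) (T.map MvPolynomial.X) (U.val.map MvPolynomial.X)) =
    h R (T.map y) (U.val.map y) := by
  have := hh.eval (MvPolynomial.aeval y : MvPolynomial (Fin k) ℚ →ₐ[ℚ] R).toRingHom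
    MvPolynomial.X T U
  simpa using this

theorem IsCurve.tendsto_aeval {k : ℕ} {c : Fin k → ℕ} {y : ℝ → Fin k → ℝ} (hy : IsCurve c y)
    (p : MvPolynomial (Fin k) ℚ) :
    Tendsto (fun t => MvPolynomial.aeval (y t) p) (𝓝[>] 0)
      (𝓝 ((MvPolynomial.eval (fun i => (c i : ℚ)) p : ℚ) : ℝ)) := by
  have h1 : ((MvPolynomial.eval (fun i => (c i : ℚ)) p : ℚ) : ℝ) =
      MvPolynomial.aeval (fun i => (c i : ℝ)) p := by
    have := MvPolynomial.map_aeval (fun i => (c i : ℚ)) (algebraMap ℚ ℝ) p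
    simpa [MvPolynomial.aeval_def] using this
  rw [h1]
  have hc : Continuous fun z : Fin k → ℝ => MvPolynomial.aeval z p := by
    simp_rw [MvPolynomial.aeval_def, ← MvPolynomial.eval_map]
    exact MvPolynomial.continuous_eval _
  exact (hc.tendsto _).comp (tendsto_pi_nhds.2 hy.tendsto)

/-- The limit of the product of `altProd` with a family. -/
noncomputable def Fam.value (h : Fam) {k : ℕ} (c : Fin k → ℕ) (S : Finset (Fin k)) : ℚ :=
  altVal c S * h ℚ [] (S.val.map fun i => (c i : ℚ))

/-- The limit is the same for every curve, so values along `perturb` can be computed along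
`genericCurve`. -/
theorem IsCurve.tendsto_alt {k : ℕ} {c : Fin k → ℕ} {y : ℝ → Fin k → ℝ} (hy : IsCurve c y)
    {h : Fam} (hh : h.IsNatural) (S : Finset (Fin k)) :
    Tendsto (fun t => h.alt (y t) [] S) (𝓝[>] 0) (𝓝 (h.value c S : ℝ)) := by
  rw [Fam.value, Rat.cast_mul]
  refine (hy.tendsto_altProd S).mul ?_
  have h1 := hy.tendsto_aeval (h (MvPolynomial (Fin k) ℚ) [] (S.val.map MvPolynomial.X))
  have h2 := hh.aeval (fun i => (c i : ℚ)) [] S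
  rw [MvPolynomial.aeval_eq_eval, List.map_nil, List.map_nil] at h2
  rw [h2] at h1
  refine h1.congr fun t => ?_
  have h3 := hh.aeval (y t) [] S
  simpa using h3

theorem continuous_ff (m : ℕ) : Continuous fun a : ℝ => ff a m :=
  (descPochhammer ℝ m).continuous

theorem ff_natCast {R : Type} [CommRing R] (a m : ℕ) : ff (a : R) m = (a.descFactorial m : R) :=
  descPochhammer_eval_eq_descFactorial R a m

/-- The recursion `alt_psiFam_cons` divides by differences of coordinates. It is therefore applied
on `genericCurve` and carried to the limit, which allows coinciding coordinates of `c`. -/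
theorem value_psiFam_cons {k : ℕ} (c : Fin k → ℕ) (S : Finset (Fin k)) {m : ℕ} (hm : 0 < m)
    (ms : List ℕ) :
    (psiFam (m :: ms)).value c S =
      ∑ i ∈ S, posSign S i * (c i).descFactorial m * (psiFam ms).value c (S.erase i) := by
  have hy := isCurve_genericCurve c
  have h1 := hy.tendsto_alt (psiFam_natural (m :: ms)) S
  have h2 : Tendsto (fun t => ∑ i ∈ S, (posSign S i : ℝ) * ff (genericCurve c t i) m *
      (psiFam ms).alt (genericCurve c t) [] (S.erase i)) (𝓝[>] 0)
      (𝓝 (∑ i ∈ S, (posSign S i : ℝ) * ff (c i : ℝ) m *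
        ((psiFam ms).value c (S.erase i) : ℝ))) := by
    refine tendsto_finsetSum _ fun i _ => Tendsto.mul (Tendsto.const_mul _ ?_)
      (hy.tendsto_alt (psiFam_natural ms) _)
    exact ((continuous_ff m).tendsto _).comp (hy.tendsto i)
  have h3 := tendsto_nhds_unique (h1.congr' ?_) h2
  · simp only [ff_natCast] at h3
    exact_mod_cast h3
  · filter_upwards [hy.pos, genericCurve_injective c] with t ht hinj
    exact alt_psiFam_cons hinj.injOn (fun i _ j _ _ => (add_pos (ht i) (ht j)).ne') hm ms

/-- In the recursion an index with `c i < m` is killed by the falling factorial; removing any other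
lowers the sum of coordinates by at least `m`. -/
theorem value_psiFam_eq_zero {k : ℕ} (c : Fin k → ℕ) (ms : List ℕ) (hms : ∀ a ∈ ms, 0 < a) :
    ∀ S : Finset (Fin k), ∑ i ∈ S, c i < ms.sum → (psiFam ms).value c S = 0 := by
  induction ms with
  | nil => intro S h; simp at h
  | cons m ms ih =>
    intro S h
    rw [value_psiFam_cons c S (hms m (by simp))]
    refine Finset.sum_eq_zero fun i hi => ?_
    rcases lt_or_ge (c i) m with hlt | hge
    · rw [Nat.descFactorial_of_lt hlt]; simp
    · rw [ih (fun a ha => hms a (by simp [ha])), mul_zero]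
      rw [← Finset.add_sum_erase S c hi, List.sum_cons] at h
      omega

theorem value_gFam {k : ℕ} (c : Fin k → ℕ) (S : Finset (Fin k)) (ms : List ℕ) (m n : ℕ) :
    (gFam ms m n).value c S =
      (psiFam ms).value c S * ff (((∑ i ∈ S, c i : ℕ) : ℚ) - m) (n - m) := by
  have : (S.val.map fun i => (c i : ℚ)).sum = ((∑ i ∈ S, c i : ℕ) : ℚ) := by
    rw [Nat.cast_sum]; rfl
  rw [Fam.value, Fam.value, gFam, this, mul_assoc]

/-- Below `m` the factor of `psiFam` vanishes; from `m` to `n - 1` the falling factorial does. -/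
theorem value_gFam_of_lt {k : ℕ} {c : Fin k → ℕ} {S : Finset (Fin k)} {ms : List ℕ}
    (hms : ∀ a ∈ ms, 0 < a) {m n : ℕ} (hm : ms.sum = m) (h : ∑ i ∈ S, c i < n) :
    (gFam ms m n).value c S = 0 := by
  rw [value_gFam]
  rcases lt_or_ge (∑ i ∈ S, c i) m with hlt | hge
  · rw [value_psiFam_eq_zero c ms hms S (hm ▸ hlt), zero_mul]
  · rw [← Nat.cast_sub hge, ff_natCast, Nat.descFactorial_of_lt (by omega)]
    simp

theorem value_gFam_of_eq {k : ℕ} {c : Fin k → ℕ} {S : Finset (Fin k)} {ms : List ℕ}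
    {m n : ℕ} (hmn : m ≤ n) (h : ∑ i ∈ S, c i = n) :
    (gFam ms m n).value c S = (n - m).factorial * (psiFam ms).value c S := by
  rw [value_gFam, h, ← Nat.cast_sub hmn, ff_natCast, Nat.descFactorial_self, mul_comm]

/-- Dividing out the variables of `T` does not change the limit on the simplex, since every polar
term tends to zero. The sets vary in the induction because a polar term lives on fewer variables. -/
theorem IsCurve.tendsto_alt_iterate {k : ℕ} {c : Fin k → ℕ} {y : ℝ → Fin k → ℝ}
    (hy : IsCurve c y) (hinj : ∀ᶠ t in 𝓝[>] 0, Function.Injective (y t)) {ms : List ℕ}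
    (hms : ∀ a ∈ ms, 0 < a) {m n : ℕ} (hm : ms.sum = m) (T : List (Fin k)) :
    T.Pairwise (· > ·) → ∀ S : Finset (Fin k), (∀ a ∈ T, ∀ s ∈ S, a < s) →
    ∑ i ∈ T.toFinset ∪ S, c i ≤ n →
    Tendsto (fun t => (Fam.step^[T.length] (gFam ms m n)).alt (y t) T S) (𝓝[>] 0)
      (𝓝 ((gFam ms m n).value c (T.toFinset ∪ S) : ℝ)) := by
  induction T with
  | nil =>
    intro _ S _ _
    simpa using hy.tendsto_alt (gFam_natural ms m n) S
  | cons i T ih =>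
    intro hT S hS hc
    rw [List.pairwise_cons] at hT
    have hiS : ∀ s ∈ S, i < s := hS i (by simp)
    have hins : (i :: T).toFinset ∪ S = T.toFinset ∪ insert i S := by
      rw [List.toFinset_cons, Finset.insert_union, Finset.union_insert]
    have h1 := ih hT.2 (insert i S) (by
      intro a ha s hs
      rcases Finset.mem_insert.1 hs with rfl | hs
      · exact hT.1 a ha
      · exact hS a (by simp [ha]) s hs) (hins ▸ hc)
    have h2 : ∀ j ∈ S, Tendsto (fun t => (posSign S j : ℝ) * (2 * y t j / (y t i + y t j)) *
        (Fam.step^[T.length] (gFam ms m n)).alt (y t) T (S.erase j)) (𝓝[>] 0) (𝓝 0) := by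
      intro j hj
      have hjn : j ∉ T.toFinset ∪ S.erase j := by
        simp only [Finset.mem_union, List.mem_toFinset, Finset.mem_erase, ne_eq, not_true,
          false_and, or_false]
        exact fun hjT => (hS j (by simp [hjT]) j hj).false
      have hsub : insert j (T.toFinset ∪ S.erase j) ⊆ (i :: T).toFinset ∪ S := by
        intro a
        simp only [Finset.mem_insert, Finset.mem_union, List.mem_toFinset, Finset.mem_erase,
          List.mem_cons]
        rintro (rfl | h | h)
        · exact Or.inr hj
        · exact Or.inl (Or.inr h)
        · exact Or.inr h.2
      have hsum := (Finset.sum_le_sum_of_subset (f := c) hsub).trans hc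
      rw [Finset.sum_insert hjn] at hsum
      have h3 := ih hT.2 (S.erase j) (fun a ha s hs => hS a (by simp [ha]) s
        (Finset.mem_of_mem_erase hs)) (by omega)
      -- Either the coefficient tends to zero, or dropping `j` brings the coordinate sum below `n`
      -- and the last factor tends to zero.
      by_cases hcj : c j = 0
      · simpa using ((hy.tendsto_coeff (hiS j hj) hcj).const_mul (posSign S j : ℝ)).mul h3
      · rw [value_gFam_of_lt hms hm (by omega), Rat.cast_zero] at h3
        have h4 := ((hy.tendsto j).const_mul 2).div ((hy.tendsto i).add (hy.tendsto j)) (by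
          norm_cast
          omega)
        simpa using (h4.const_mul (posSign S j : ℝ)).mul h3
    have h5 := h1.add (tendsto_finsetSum S h2)
    rw [hins]
    simp only [Finset.sum_const_zero, add_zero] at h5
    refine h5.congr' ?_
    filter_upwards [hy.pos, hinj] with t ht hinj
    rw [List.length_cons, Function.iterate_succ_apply',
      Fam.alt_insert hiS hinj.injOn (fun i j _ => (add_pos (ht i) (ht j)).ne')
        ((gFam_natural ms m n).iterate _) ((gFam_cancellative ms m n).iterate _)]
    ring

end StrictPaths

/-! ### Weights of monomials and antipolynomials. -/

namespace StrictPaths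
open Polynomial

/-- The weight of an exponent vector with respect to the weights `w` of the variables. -/
def wt {k : ℕ} (w : Fin k → ℤ) : Expo k →+ ℤ where
  toFun e := ∑ i, w i * ofLex e (OrderDual.toDual i)
  map_zero' := Finset.sum_eq_zero fun _ _ => mul_zero _
  map_add' a b := by
    rw [← Finset.sum_add_distrib]
    exact Finset.sum_congr rfl fun i _ => mul_add _ _ _

theorem wt_expo {k : ℕ} (w c : Fin k → ℤ) : wt w (expo c) = ∑ i, w i * c i := rfl

theorem wt_expo_single {k : ℕ} (w : Fin k → ℤ) (i : Fin k) : wt w (expo (Pi.single i 1)) = w i := by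
  simp [wt_expo, Pi.single_apply]

theorem expo_single_lt {k : ℕ} {i j : Fin k} (hij : i < j) :
    expo (Pi.single i 1) < expo (Pi.single j 1) := by
  refine ⟨OrderDual.toDual j, fun l hl => ?_, ?_⟩
  · have hl : j < OrderDual.ofDual l := hl
    simp [expo, Pi.single_apply, hl.ne', (hij.trans hl).ne']
  · simp [expo, Pi.single_apply, hij.ne']

/-- All monomials of `f` have weight at most `d`. -/
def WtLE {k : ℕ} (w : Fin k → ℤ) (d : ℤ) (f : Laurent k) : Prop :=
  ∀ e, f.coeff e ≠ 0 → wt w e ≤ d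

section
variable {k : ℕ} {w : Fin k → ℤ} {d d' : ℤ} {f g : Laurent k}

theorem WtLE.mono (h : WtLE w d f) (hd : d ≤ d') : WtLE w d' f := fun e he => (h e he).trans hd

theorem wtLE_zero : WtLE w d (0 : Laurent k) := fun _ he => absurd HahnSeries.coeff_zero he

theorem WtLE.add (hf : WtLE w d f) (hg : WtLE w d g) : WtLE w d (f + g) := by
  intro e he
  by_contra h
  have h1 := not_imp_comm.1 (hf e) h
  have h2 := not_imp_comm.1 (hg e) h
  exact he (by rw [HahnSeries.coeff_add, h1, h2, add_zero])

theorem WtLE.neg (hf : WtLE w d f) : WtLE w d (-f) := fun e he =>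
  hf e fun h => he (by rw [HahnSeries.coeff_neg, h, neg_zero])

theorem WtLE.sub (hf : WtLE w d f) (hg : WtLE w d g) : WtLE w d (f - g) :=
  sub_eq_add_neg f g ▸ hf.add hg.neg

theorem WtLE.mul (hf : WtLE w d f) (hg : WtLE w d' g) : WtLE w (d + d') (f * g) := by
  intro e he
  obtain ⟨a, ha, b, hb, rfl⟩ := HahnSeries.support_mul_subset (HahnSeries.mem_support _ _ |>.2 he)
  rw [map_add]
  exact add_le_add (hf a ha) (hg b hb)

theorem wtLE_single (e : Expo k) (a : ℚ) : WtLE w (wt w e) (HahnSeries.single e a) := by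
  intro e' he'
  rw [HahnSeries.coeff_single] at he'
  rw [show e' = e by by_contra h; simp [h] at he']

theorem wtLE_one : WtLE w 0 (1 : Laurent k) := by
  simpa using wtLE_single (w := w) (0 : Expo k) 1

theorem wtLE_algebraMap (a : ℚ) : WtLE w 0 (algebraMap ℚ (Laurent k) a) := by
  have h : algebraMap ℚ (Laurent k) a = HahnSeries.C a :=
    RingHom.congr_fun (Subsingleton.elim _ _) a
  rw [h, HahnSeries.C_apply]
  simpa only [map_zero] using wtLE_single (w := w) (0 : Expo k) a

theorem wtLE_intCast (a : ℤ) : WtLE w 0 (a : Laurent k) := by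
  simpa using wtLE_algebraMap (w := w) (a : ℚ)

theorem wtLE_natCast (a : ℕ) : WtLE w 0 (a : Laurent k) := by
  simpa using wtLE_intCast (w := w) (a : ℤ)

theorem wtLE_sum {ι : Type*} {s : Finset ι} {F : ι → Laurent k} (h : ∀ i ∈ s, WtLE w d (F i)) :
    WtLE w d (∑ i ∈ s, F i) :=
  Finset.sum_induction _ _ (fun _ _ => WtLE.add) wtLE_zero h

theorem wtLE_prod {ι : Type*} {s : Finset ι} {F : ι → Laurent k} {D : ι → ℤ}
    (h : ∀ i ∈ s, WtLE w (D i) (F i)) : WtLE w (∑ i ∈ s, D i) (∏ i ∈ s, F i) := by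
  classical
  induction s using Finset.induction_on with
  | empty => simpa using wtLE_one
  | insert i s hi ih =>
    rw [Finset.sum_insert hi, Finset.prod_insert hi]
    exact (h i (by simp)).mul (ih fun j hj => h j (by simp [hj]))

theorem WtLE.ff (hf : WtLE w d f) (hd : 0 ≤ d) (n : ℕ) : WtLE w (n * d) (ff f n) := by
  rw [StrictPaths.ff, descPochhammer_eval_eq_prod_range]
  have := wtLE_prod (s := Finset.range n) (F := fun j => f - (j : Laurent k)) (D := fun _ => d)
    fun j _ => hf.sub ((wtLE_natCast j).mono hd)
  simpa using this

/-- The image of the variable `x_i` in the field of formal series. -/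
noncomputable def mon (i : Fin k) : Laurent k := HahnSeries.single (expo (Pi.single i 1)) 1

theorem expand_algebraMap (p : MvPolynomial (Fin k) ℚ) :
    expand k (algebraMap _ (RatFun k) p) = polyToLaurent k p :=
  IsFractionRing.lift_algebraMap (K := RatFun k) (polyToLaurent_injective k) p

theorem expand_x (i : Fin k) : expand k (x i) = mon i := by
  rw [x, expand_algebraMap, polyToLaurent, MvPolynomial.eval₂Hom_X', mon]

theorem wtLE_mon (i : Fin k) : WtLE w (w i) (mon i) := by
  have := wtLE_single (w := w) (expo (Pi.single i 1)) 1
  rwa [wt_expo_single] at this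

/-- Every monomial of the expansion of `1 / (x_i + x_j)`, `i < j`, is of the form
`x_j ^ l / x_i ^ (l + 1)`. -/
theorem wtLE_inv_add {i j : Fin k} (hij : i < j) (hw : w j ≤ w i) (h0 : mon i + mon j ≠ 0) :
    WtLE w (-w i) (mon i + mon j)⁻¹ := by
  set u := (mon i + mon j)⁻¹ with hu
  by_contra hcon
  simp only [WtLE, not_forall, not_le] at hcon
  obtain ⟨e₀, he₀, hwe₀⟩ := hcon
  -- Take the least exponent `e` violating the bound. Comparing coefficients of $x^{e+a}$ in
  -- $u\,(x_i+x_j)=1$ shows that `e + a - b` is in the support; it is smaller, and its weight is no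
  -- less, so it also violates the bound.
  set B : Set (Expo k) := {e | u.coeff e ≠ 0 ∧ -w i < wt w e} with hB
  have hwf : B.IsWF := u.isWF_support.mono fun e he => he.1
  have hne : B.Nonempty := ⟨e₀, he₀, hwe₀⟩
  obtain ⟨h1, h2⟩ := hwf.min_mem hne
  set e := hwf.min hne with he
  set a := expo (Pi.single i 1) with ha
  set b := expo (Pi.single j 1) with hb
  have hab : a < b := expo_single_lt hij
  have hwa : wt w a = w i := wt_expo_single w i
  have hwb : wt w b = w j := wt_expo_single w j
  have hone : (u * mon i + u * mon j).coeff (e + a) = 0 := by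
    rw [← mul_add, hu, inv_mul_cancel₀ h0, HahnSeries.coeff_one, if_neg]
    intro h
    have := congrArg (wt w) h
    rw [map_add, map_zero, hwa] at this
    omega
  have hlt : e + a - b < e := by
    rw [add_sub_assoc]
    exact add_lt_of_neg_right e (sub_neg.2 hab)
  rw [HahnSeries.coeff_add, mon, mon, HahnSeries.coeff_mul_single_add,
    show e + a = (e + a - b) + b by abel, HahnSeries.coeff_mul_single_add, mul_one, mul_one] at hone
  refine hwf.not_lt_min hne (a := e + a - b) ⟨fun h => h1 ?_, ?_⟩ hlt
  · rwa [h, add_zero] at hone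
  · rw [map_sub, map_add, hwa, hwb]
    omega

end

theorem mon_injective {k : ℕ} : Function.Injective (mon (k := k)) := fun i j h =>
  x_injective ((expand k).injective (by rw [expand_x, expand_x, h]))

theorem mon_add_ne_zero {k : ℕ} (i j : Fin k) : mon i + mon j ≠ 0 := by
  rw [← expand_x, ← expand_x, x, x, ← map_add, ← map_add, expand_algebraMap]
  intro h
  have h2 := polyToLaurent_injective k (h.trans (map_zero _).symm)
  have := congrArg (MvPolynomial.eval fun _ => (1 : ℚ)) h2
  norm_num at this

section
variable {k : ℕ} {w : Fin k → ℤ}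

theorem wtLE_ratio {i j : Fin k} (hij : i < j) (hw : w j ≤ w i) :
    WtLE w 0 ((mon i - mon j) / (mon i + mon j)) := by
  rw [div_eq_mul_inv]
  have := ((wtLE_mon (w := w) i).sub ((wtLE_mon j).mono hw)).mul
    (wtLE_inv_add hij hw (mon_add_ne_zero i j))
  rwa [add_neg_cancel] at this

theorem wtLE_altProd {S : Finset (Fin k)} (hw : ∀ i ∈ S, ∀ j ∈ S, i < j → w j ≤ w i) :
    WtLE w 0 (altProd mon S) := by
  have h : ∀ i ∈ S, ∀ j ∈ S, WtLE w 0
      (if i < j then (mon i - mon j) / (mon i + mon j) else 1) := fun i hi j hj => by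
    by_cases hij : i < j
    · rw [if_pos hij]
      exact wtLE_ratio hij (hw i hi j hj hij)
    · rw [if_neg hij]
      exact wtLE_one
  have := wtLE_prod (s := S) (D := fun _ => 0) fun i hi => by
    have := wtLE_prod (s := S) (D := fun _ => 0) (h i hi)
    simpa using this
  simpa [altProd] using this

/-- The subalgebra of series all of whose monomials have non-positive weight. -/
noncomputable def wtSubalgebra (w : Fin k → ℤ) : Subalgebra ℚ (Laurent k) where
  carrier := {f | WtLE w 0 f}
  mul_mem' hf hg := by simpa using WtLE.mul hf hg
  add_mem' := WtLE.add
  algebraMap_mem' := wtLE_algebraMap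

/-- By naturality a family evaluated at elements of the subalgebra `wtSubalgebra w` takes its value
there. -/
theorem Fam.IsNatural.wtLE {h : Fam} (hh : h.IsNatural) {T : List (Fin k)} {S : Finset (Fin k)}
    (hT : ∀ i ∈ T, w i ≤ 0) (hS : ∀ i ∈ S, w i ≤ 0) :
    WtLE w 0 (h (Laurent k) (T.map mon) (S.val.map mon)) := by
  classical
  -- The value 0 is a default for variables of positive weight, which do not occur in `T` or `S`.
  let y : Fin k → wtSubalgebra w := fun i =>
    if hi : w i ≤ 0 then ⟨mon i, (wtLE_mon i).mono hi⟩ else 0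
  have hy : ∀ i, w i ≤ 0 → ((y i : Laurent k)) = mon i := fun i hi => by simp [y, hi]
  have key := hh.eval (wtSubalgebra w).val.toRingHom y T S
  have h1 : T.map mon = T.map fun i => (wtSubalgebra w).val.toRingHom (y i) :=
    List.map_congr_left fun i hi => (hy i (hT i hi)).symm
  have h2 : S.val.map mon = S.val.map fun i => (wtSubalgebra w).val.toRingHom (y i) :=
    Multiset.map_congr rfl fun i hi => (hy i (hS i hi)).symm
  rw [h1, h2, ← key]
  exact Subtype.prop _

theorem Fam.IsNatural.wtLE_alt {h : Fam} (hh : h.IsNatural) {T : List (Fin k)}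
    {S : Finset (Fin k)} (hT : ∀ i ∈ T, w i ≤ 0) (hS : ∀ i ∈ S, w i ≤ 0)
    (hw : ∀ i ∈ S, ∀ j ∈ S, i < j → w j ≤ w i) : WtLE w 0 (h.alt mon T S) := by
  simpa [Fam.alt] using (wtLE_altProd hw).mul (hh.wtLE hT hS)

/-- The degree bound is visible in the alternating recursion: each part `m` contributes a falling
factorial of degree `m`, and `altProd` has degree at most zero. -/
theorem wtLE_alt_psiFam (ms : List ℕ) (hms : ∀ a ∈ ms, 0 < a) :
    ∀ S : Finset (Fin k), WtLE 1 ms.sum ((psiFam ms).alt mon [] S) := by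
  induction ms with
  | nil =>
    intro S
    simpa [Fam.alt, psiFam] using wtLE_altProd (w := (1 : Fin k → ℤ)) (S := S) (by simp)
  | cons m ms ih =>
    intro S
    rw [alt_psiFam_cons (y := mon (k := k)) mon_injective.injOn (fun i _ j _ _ => mon_add_ne_zero i j)
      (hms m (by simp))]
    refine wtLE_sum fun i _ => ?_
    have h1 := ((wtLE_mon (w := (1 : Fin k → ℤ)) i).ff (by simp) m)
    have h2 := ((wtLE_intCast (w := (1 : Fin k → ℤ)) (posSign S i)).mul h1).mul
      (ih (fun a ha => hms a (by simp [ha])) (S.erase i))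
    exact h2.mono (by simp)

theorem wtLE_alt_gFam {ms : List ℕ} (hms : ∀ a ∈ ms, 0 < a) {m n : ℕ} (hm : ms.sum = m)
    (hmn : m ≤ n) (S : Finset (Fin k)) : WtLE 1 n ((gFam ms m n).alt mon [] S) := by
  have h1 : WtLE (1 : Fin k → ℤ) 1 ((S.val.map mon).sum - (m : Laurent k)) :=
    (wtLE_sum (s := S) fun i _ => wtLE_mon i).sub ((wtLE_natCast m).mono zero_le_one)
  have h2 := (wtLE_alt_psiFam ms hms S).mul (h1.ff zero_le_one (n - m))
  have h3 : (gFam ms m n).alt mon [] S =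
      (psiFam ms).alt mon [] S * ff ((S.val.map mon).sum - (m : Laurent k)) (n - m) := by
    simp only [Fam.alt, gFam, List.map_nil, mul_assoc]
  rw [h3]
  refine h2.mono ?_
  rw [hm]
  push_cast [hmn]
  linarith

end

/-- Every monomial of `f` contains some variable in a negative power. -/
def IsAntipoly {k : ℕ} (f : Laurent k) : Prop :=
  ∀ c : Fin k → ℤ, f.coeff (expo c) ≠ 0 → ∃ i, c i < 0

theorem IsAntipoly.add {k : ℕ} {f g : Laurent k} (hf : IsAntipoly f) (hg : IsAntipoly g) :
    IsAntipoly (f + g) := by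
  intro c hc
  by_contra h
  have h1 := not_imp_comm.1 (hf c) h
  have h2 := not_imp_comm.1 (hg c) h
  exact hc (by rw [HahnSeries.coeff_add, h1, h2, add_zero])

theorem WtLE.isAntipoly {k : ℕ} {i : Fin k} {f : Laurent k} (hf : WtLE (Pi.single i 1) (-1) f) :
    IsAntipoly f := by
  intro c hc
  have := hf _ hc
  rw [wt_expo] at this
  simp only [Pi.single_apply, ite_mul, one_mul, zero_mul, Finset.sum_ite_eq', Finset.mem_univ,
    if_true] at this
  exact ⟨i, by omega⟩

/-- The difference is the sum of polar terms. With weight 1 on `x_i` and 0 elsewhere, $1/(x_i+x_j)$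
has weight at most $-1$, and the other factors do not involve `x_i`. -/
theorem Fam.isAntipoly_alt_insert_sub {k : ℕ} {h : Fam} (hh : h.IsNatural) (hc : h.IsCancellative)
    {T : List (Fin k)} {S : Finset (Fin k)} {i : Fin k} (hT : i ∉ T) (hS : ∀ j ∈ S, i < j) :
    IsAntipoly (h.alt mon T (insert i S) - h.step.alt mon (i :: T) S) := by
  rw [Fam.alt_insert hS mon_injective.injOn (fun i j _ => mon_add_ne_zero i j) hh hc,
    sub_sub_cancel_left]
  have h0 : ∀ j, j ≠ i → (Pi.single i 1 : Fin k → ℤ) j = 0 := fun j hj => Pi.single_eq_of_ne hj _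
  have hne : ∀ j ∈ S, j ≠ i := fun j hj => (hS j hj).ne'
  refine WtLE.isAntipoly (i := i) (wtLE_sum fun j hj => ?_).neg
  have h1 := wtLE_inv_add (w := Pi.single i 1) (hS j hj) (by simp [h0 j (hne j hj)])
    (mon_add_ne_zero i j)
  have h2 : WtLE (Pi.single i 1) 0 (h.alt mon T (S.erase j)) := by
    have hz : ∀ a ∈ S.erase j, (Pi.single i 1 : Fin k → ℤ) a = 0 := fun a ha =>
      h0 a (hne a (Finset.mem_of_mem_erase ha))
    exact hh.wtLE_alt (fun a ha => (h0 a fun h => hT (h ▸ ha)).le) (fun a ha => (hz a ha).le)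
      fun a ha b hb _ => (by rw [hz a ha, hz b hb])
  have h3 := ((wtLE_intCast (posSign S j)).mul ((((wtLE_natCast 2).mul
    (wtLE_mon j)).mul h1))).mul h2
  rw [h0 j (hne j hj), Pi.single_eq_same] at h3
  simpa [div_eq_mul_inv] using h3

theorem Fam.isAntipoly_alt_sub_iterate {k : ℕ} {h : Fam} (hh : h.IsNatural)
    (hc : h.IsCancellative) (T : List (Fin k)) : T.Pairwise (· > ·) →
    ∀ S : Finset (Fin k), (∀ a ∈ T, ∀ s ∈ S, a < s) →
    IsAntipoly (h.alt mon [] (T.toFinset ∪ S) - (Fam.step^[T.length] h).alt mon T S) := by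
  induction T with
  | nil => intro _ S _ c; simp
  | cons i T ih =>
    intro hT S hS
    rw [List.pairwise_cons] at hT
    have hins : (i :: T).toFinset ∪ S = T.toFinset ∪ insert i S := by
      rw [List.toFinset_cons, Finset.insert_union, Finset.union_insert]
    have h1 := ih hT.2 (insert i S) (by
      intro a ha s hs
      rcases Finset.mem_insert.1 hs with rfl | hs
      · exact hT.1 a ha
      · exact hS a (by simp [ha]) s hs)
    have h2 := Fam.isAntipoly_alt_insert_sub (hh.iterate T.length) (hc.iterate T.length)
      (fun hi => (hT.1 i hi).false) (hS i (by simp))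
    rw [hins, List.length_cons, Function.iterate_succ_apply']
    have := h1.add h2
    rwa [sub_add_sub_cancel] at this

theorem Fam.IsNatural.map_alt {h : Fam} (hh : h.IsNatural) {k : ℕ} {K L : Type} [Field K]
    [Algebra ℚ K] [Field L] [Algebra ℚ L] (f : K →+* L) (y : Fin k → K) (T : List (Fin k))
    (S : Finset (Fin k)) : f (h.alt y T S) = h.alt (fun i => f (y i)) T S := by
  rw [Fam.alt, Fam.alt, map_mul, hh.eval f y T S, altProd, altProd]
  simp only [map_prod, apply_ite f, map_div₀, map_sub, map_add, map_one]

theorem Fam.IsNatural.expand_alt {h : Fam} (hh : h.IsNatural) {k : ℕ} (T : List (Fin k))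
    (S : Finset (Fin k)) : expand k (h.alt x T S) = h.alt mon T S := by
  rw [hh.map_alt]
  simp only [expand_x]

end StrictPaths

/-! ### Newton interpolation on the simplex. -/

namespace StrictPaths

/-- For a monomial `t` of top degree, the combinatorial Nullstellensatz gives a non-root in the grid
$\prod\{0,\dots,t_i\}$, which lies in the simplex. -/
theorem eq_zero_of_eval_simplex {k n : ℕ} {p : MvPolynomial (Fin k) ℚ} (hp : p.totalDegree ≤ n)
    (h : ∀ c : Fin k → ℕ, ∑ i, c i ≤ n → MvPolynomial.eval (fun i => (c i : ℚ)) p = 0) :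
    p = 0 := by
  by_contra h0
  obtain ⟨t, ht, htd⟩ := Finset.exists_mem_eq_sup p.support
    (MvPolynomial.support_nonempty.2 h0) fun s => s.sum fun _ e => e
  have htd' : p.totalDegree = t.degree := htd
  obtain ⟨s, hs, hs0⟩ := MvPolynomial.combinatorial_nullstellensatz_exists_eval_nonzero p t
    (MvPolynomial.mem_support_iff.1 ht) htd'
    (fun i => (Finset.range (t i + 1)).image fun a : ℕ => (a : ℚ)) fun i => by
      rw [Finset.card_image_of_injective _ Nat.cast_injective, Finset.card_range]
      exact Nat.lt_succ_self _
  have hc : ∀ i, ∃ a : ℕ, a ≤ t i ∧ (a : ℚ) = s i := fun i => by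
    obtain ⟨a, ha, has⟩ := Finset.mem_image.1 (hs i)
    exact ⟨a, Nat.lt_succ_iff.1 (Finset.mem_range.1 ha), has⟩
  choose c hct hcs using hc
  refine hs0 ?_
  rw [show s = fun i => (c i : ℚ) from funext fun i => (hcs i).symm]
  refine h c ((Finset.sum_le_sum fun i _ => hct i).trans ?_)
  rw [← Finsupp.degree_eq_sum, ← htd']
  exact hp

/-- The product of the falling factorials of the variables. -/
noncomputable def newton {k : ℕ} (c : Fin k → ℕ) : MvPolynomial (Fin k) ℚ :=
  ∏ i, ff (MvPolynomial.X i) (c i)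

theorem eval_newton {k : ℕ} (c d : Fin k → ℕ) :
    MvPolynomial.eval (fun i => (d i : ℚ)) (newton c) = ∏ i, ((d i).descFactorial (c i) : ℚ) := by
  simp only [newton, map_prod, ff_map, MvPolynomial.eval_X, ff_natCast]

theorem eval_newton_self {k : ℕ} (c : Fin k → ℕ) :
    MvPolynomial.eval (fun i => (c i : ℚ)) (newton c) = ∏ i, ((c i).factorial : ℚ) := by
  simp only [eval_newton, Nat.descFactorial_self]

theorem eval_newton_of_ne {k : ℕ} {c d : Fin k → ℕ} (hcd : c ≠ d) (h : ∑ i, d i ≤ ∑ i, c i) :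
    MvPolynomial.eval (fun i => (d i : ℚ)) (newton c) = 0 := by
  have : ∃ i, d i < c i := by
    by_contra hcon
    push Not at hcon
    have heq := (Finset.sum_eq_sum_iff_of_le fun i _ => hcon i).1
      (le_antisymm (Finset.sum_le_sum fun i _ => hcon i) h)
    exact hcd (funext fun i => heq i (Finset.mem_univ i))
  obtain ⟨i, hi⟩ := this
  rw [eval_newton]
  refine Finset.prod_eq_zero (Finset.mem_univ i) ?_
  rw [Nat.descFactorial_of_lt hi, Nat.cast_zero]

theorem totalDegree_newton_le {k : ℕ} (c : Fin k → ℕ) :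
    (newton c).totalDegree ≤ ∑ i, c i := by
  refine (MvPolynomial.totalDegree_finsetProd _ _).trans (Finset.sum_le_sum fun i _ => ?_)
  rw [ff, descPochhammer_eval_eq_prod_range]
  refine (MvPolynomial.totalDegree_finsetProd _ _).trans ?_
  refine (Finset.sum_le_card_nsmul _ _ 1 fun j _ => ?_).trans (by simp)
  rw [← map_natCast (MvPolynomial.C (R := ℚ) (σ := Fin k))]
  exact (MvPolynomial.totalDegree_sub_C_le _ _).trans (MvPolynomial.totalDegree_X _).le

/-- Both sides have degree at most `n` and agree on the simplex: at a point `d` of it only the term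
`c = d` can survive. -/
theorem eq_sum_newton {k n : ℕ} {p : MvPolynomial (Fin k) ℚ} (hp : p.totalDegree ≤ n)
    (h : ∀ c : Fin k → ℕ, ∑ i, c i < n → MvPolynomial.eval (fun i => (c i : ℚ)) p = 0) :
    p = ∑ c ∈ Finset.piAntidiag (Finset.univ : Finset (Fin k)) n, MvPolynomial.C
      (MvPolynomial.eval (fun i => (c i : ℚ)) p / ∏ i, ((c i).factorial : ℚ)) * newton c := by
  rw [← sub_eq_zero]
  have hmem : ∀ c : Fin k → ℕ, c ∈ Finset.piAntidiag (Finset.univ : Finset (Fin k)) n ↔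
      ∑ i, c i = n := fun c => by simp [Finset.mem_piAntidiag]
  refine eq_zero_of_eval_simplex (n := n) ?_ fun d hd => ?_
  · refine (MvPolynomial.totalDegree_sub _ _).trans (max_le hp ?_)
    refine MvPolynomial.totalDegree_finsetSum_le fun c hc => ?_
    refine (MvPolynomial.totalDegree_mul _ _).trans ?_
    rw [MvPolynomial.totalDegree_C, zero_add]
    exact (totalDegree_newton_le c).trans ((hmem c).1 hc).le
  · have h0 : (∏ i, ((d i).factorial : ℚ)) ≠ 0 :=
      Finset.prod_ne_zero_iff.2 fun i _ => by exact_mod_cast (d i).factorial_ne_zero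
    rw [map_sub, map_sum, sub_eq_zero]
    simp only [map_mul, MvPolynomial.eval_C]
    have hz : ∀ c ∈ Finset.piAntidiag (Finset.univ : Finset (Fin k)) n, c ≠ d →
        MvPolynomial.eval (fun i => (d i : ℚ)) (newton c) = 0 := fun c hc hcd =>
      eval_newton_of_ne hcd (((hmem c).1 hc).symm ▸ hd)
    rcases hd.lt_or_eq with hlt | heq
    · rw [h d hlt]
      refine (Finset.sum_eq_zero fun c hc => ?_).symm
      rw [hz c hc, mul_zero]
      rintro rfl
      exact hlt.ne ((hmem c).1 hc)
    · rw [Finset.sum_eq_single_of_mem d ((hmem d).2 heq) fun c hc hcd => by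
        rw [hz c hc hcd, mul_zero], eval_newton_self, div_mul_cancel₀ _ h0]

theorem coeff_prod_aeval_X {k : ℕ} (q : Fin k → Polynomial ℚ) (s : Fin k →₀ ℕ) :
    (∏ i, Polynomial.aeval (MvPolynomial.X i : MvPolynomial (Fin k) ℚ) (q i)).coeff s =
      ∏ i, (q i).coeff (s i) := by
  classical
  -- The range is enlarged by `s i + 1` so that the exponent `s i` always lies in it.
  set t : Fin k → Finset ℕ := fun i => Finset.range ((q i).natDegree + 1 + (s i + 1)) with ht
  have h1 : ∀ i, Polynomial.aeval (MvPolynomial.X i : MvPolynomial (Fin k) ℚ) (q i) =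
      ∑ a ∈ t i, MvPolynomial.C ((q i).coeff a) * MvPolynomial.X i ^ a := fun i => by
    rw [Polynomial.aeval_eq_sum_range' (n := (q i).natDegree + 1 + (s i + 1)) (by omega)]
    simp only [ht, MvPolynomial.smul_eq_C_mul]
  have h2 : ∀ a : Fin k → ℕ, ∏ i, (MvPolynomial.X i : MvPolynomial (Fin k) ℚ) ^ a i =
      MvPolynomial.monomial (Finsupp.equivFunOnFinite.symm a) 1 := fun a => by
    rw [MvPolynomial.monomial_eq, Finsupp.prod_fintype _ _ (by simp)]
    simp
  simp only [h1]
  rw [Finset.prod_univ_sum, MvPolynomial.coeff_sum]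
  simp only [Finset.prod_mul_distrib, h2, ← map_prod, MvPolynomial.coeff_C_mul,
    MvPolynomial.coeff_monomial, mul_ite, mul_one, mul_zero]
  rw [Finset.sum_eq_single_of_mem (s : Fin k → ℕ)]
  · simp
  · simp only [Fintype.mem_piFinset, ht, Finset.mem_range]
    omega
  · intro a _ ha
    rw [if_neg]
    intro h
    exact ha (by rw [← h]; rfl)

/-- Each falling factorial is monic of degree `c i`, and if `c ≠ d` have equal sums, some `d i`
exceeds that degree. -/
theorem coeff_newton {k : ℕ} {c d : Fin k → ℕ} (h : ∑ i, c i = ∑ i, d i) :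
    (newton c).coeff (Finsupp.equivFunOnFinite.symm d) = if c = d then 1 else 0 := by
  have h1 : newton c = ∏ i, Polynomial.aeval (MvPolynomial.X i : MvPolynomial (Fin k) ℚ)
      (descPochhammer ℚ (c i)) := by
    refine Finset.prod_congr rfl fun i _ => ?_
    rw [ff, ← descPochhammer_map (algebraMap ℚ (MvPolynomial (Fin k) ℚ)), Polynomial.eval_map,
      Polynomial.aeval_def]
  rw [h1, coeff_prod_aeval_X]
  split_ifs with hcd
  · subst hcd
    refine Finset.prod_eq_one fun i _ => ?_
    have := monic_descPochhammer ℚ (c i)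
    rw [Polynomial.Monic, Polynomial.leadingCoeff, descPochhammer_natDegree] at this
    exact this
  · have : ∃ i, c i < d i := by
      by_contra hcon
      push Not at hcon
      have heq := (Finset.sum_eq_sum_iff_of_le fun i _ => hcon i).1 h.symm
      exact hcd (funext fun i => (heq i (Finset.mem_univ i)).symm)
    obtain ⟨i, hi⟩ := this
    refine Finset.prod_eq_zero (Finset.mem_univ i) (Polynomial.coeff_eq_zero_of_natDegree_lt ?_)
    rw [descPochhammer_natDegree]
    exact hi

theorem coeff_eq_eval_div {k n : ℕ} {p : MvPolynomial (Fin k) ℚ} (hp : p.totalDegree ≤ n)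
    (h : ∀ c : Fin k → ℕ, ∑ i, c i < n → MvPolynomial.eval (fun i => (c i : ℚ)) p = 0)
    {d : Fin k → ℕ} (hd : ∑ i, d i = n) :
    p.coeff (Finsupp.equivFunOnFinite.symm d) =
      MvPolynomial.eval (fun i => (d i : ℚ)) p / ∏ i, ((d i).factorial : ℚ) := by
  have hmem : ∀ c : Fin k → ℕ, c ∈ Finset.piAntidiag (Finset.univ : Finset (Fin k)) n ↔
      ∑ i, c i = n := fun c => by simp [Finset.mem_piAntidiag]
  conv_lhs => rw [eq_sum_newton hp h]
  rw [MvPolynomial.coeff_sum]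
  simp only [MvPolynomial.coeff_C_mul]
  rw [Finset.sum_eq_single_of_mem d ((hmem d).2 hd) fun c hc hcd => by
    rw [coeff_newton (((hmem c).1 hc).trans hd.symm), if_neg hcd, mul_zero],
    coeff_newton rfl, if_pos rfl, mul_one]

end StrictPaths

/-! ### The polynomial component of g. -/

namespace StrictPaths
open Filter Topology

/-- The numerator of the product of `altProd` with a family. -/
noncomputable def Fam.num (h : Fam) (k : ℕ) : MvPolynomial (Fin k) ℚ :=
  (∏ p ∈ pairs k, (MvPolynomial.X p.1 - MvPolynomial.X p.2)) *
    h (MvPolynomial (Fin k) ℚ) [] (Finset.univ.val.map MvPolynomial.X)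

theorem Fam.IsNatural.map_num_div {h : Fam} (hh : h.IsNatural) {k : ℕ} {K : Type} [Field K]
    [Algebra ℚ K] (f : MvPolynomial (Fin k) ℚ →+* K) :
    f (h.num k) / f (denom k) = h.alt (fun i => f (MvPolynomial.X i)) [] Finset.univ := by
  have := hh.eval f MvPolynomial.X [] Finset.univ
  rw [List.map_nil, List.map_nil] at this
  rw [Fam.num, denom, Fam.alt, altProd_univ, map_mul, map_prod, map_prod, this, List.map_nil,
    mul_div_right_comm, ← Finset.prod_div_distrib]
  simp only [map_sub, map_add]

theorem Fam.IsNatural.alt_x_eq {h : Fam} (hh : h.IsNatural) (k : ℕ) :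
    h.alt (x (k := k)) [] Finset.univ =
      algebraMap _ (RatFun k) (h.num k) / algebraMap _ (RatFun k) (denom k) :=
  (hh.map_num_div (algebraMap _ (RatFun k))).symm

theorem Fam.IsNatural.tendsto_num_div {h : Fam} (hh : h.IsNatural) {k : ℕ} (c : Fin k → ℕ) :
    Tendsto (fun t : ℝ => MvPolynomial.aeval (perturb c t) (h.num k) /
      MvPolynomial.aeval (perturb c t) (denom k)) (𝓝[>] 0)
      (𝓝 (h.value c Finset.univ : ℝ)) := by
  refine ((isCurve_perturb c).tendsto_alt hh Finset.univ).congr fun t => ?_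
  have := hh.map_num_div (MvPolynomial.aeval (perturb c t) :
    MvPolynomial (Fin k) ℚ →ₐ[ℚ] ℝ).toRingHom
  simpa using this.symm

theorem Fam.IsNatural.hasValueAt {h : Fam} (hh : h.IsNatural) {k : ℕ} (c : Fin k → ℕ) :
    HasValueAt (h.alt x [] Finset.univ) c (h.value c Finset.univ) :=
  ⟨h.num k, hh.alt_x_eq k, hh.tendsto_num_div c⟩

theorem denom_ne_zero (k : ℕ) : denom k ≠ 0 := by
  refine Finset.prod_ne_zero_iff.2 fun r _ h => ?_
  have := congrArg (MvPolynomial.eval fun _ => (1 : ℚ)) h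
  norm_num at this

theorem eventually_aeval_denom_ne_zero {k : ℕ} (c : Fin k → ℕ) :
    ∀ᶠ t in 𝓝[>] (0 : ℝ), MvPolynomial.aeval (perturb c t) (denom k) ≠ 0 := by
  filter_upwards [(isCurve_perturb c).pos] with t ht
  rw [denom, map_prod]
  refine Finset.prod_ne_zero_iff.2 fun p _ => ?_
  rw [map_add, MvPolynomial.aeval_X, MvPolynomial.aeval_X]
  exact (add_pos (ht _) (ht _)).ne'

theorem Fam.IsNatural.hasValueAt_sub {h : Fam} (hh : h.IsNatural) {k : ℕ} (c : Fin k → ℕ)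
    (P : MvPolynomial (Fin k) ℚ) :
    HasValueAt (h.alt x [] Finset.univ - algebraMap _ (RatFun k) P) c
      (h.value c Finset.univ - MvPolynomial.eval (fun i => (c i : ℚ)) P) := by
  refine ⟨h.num k - P * denom k, ?_, ?_⟩
  · have h0 : algebraMap _ (RatFun k) (denom k) ≠ 0 :=
      (map_ne_zero_iff _ (IsFractionRing.injective _ _)).2 (denom_ne_zero k)
    rw [hh.alt_x_eq, map_sub, map_mul, sub_div, mul_div_cancel_right₀ _ h0]
  · rw [Rat.cast_sub]
    refine ((hh.tendsto_num_div c).sub ((isCurve_perturb c).tendsto_aeval P)).congr' ?_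
    filter_upwards [eventually_aeval_denom_ne_zero c] with t ht
    rw [map_sub, map_mul, sub_div, mul_div_cancel_right₀ _ ht]

/-- All the indices in decreasing order. -/
def indices (k : ℕ) : List (Fin k) := (List.finRange k).reverse

theorem pairwise_indices (k : ℕ) : (indices k).Pairwise (· > ·) := by
  rw [indices, List.pairwise_reverse]
  exact List.pairwise_lt_finRange k

theorem toFinset_indices_union (k : ℕ) : (indices k).toFinset ∪ ∅ = Finset.univ := by
  ext i; simp [indices]

/-- The polynomial component of the function `g`. -/
noncomputable def polyComp (k : ℕ) (ms : List ℕ) (m n : ℕ) : MvPolynomial (Fin k) ℚ :=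
  Fam.step^[(indices k).length] (gFam ms m n) (MvPolynomial (Fin k) ℚ)
    ((indices k).map MvPolynomial.X) 0

/-- Once all the variables have been divided out, `altProd` runs over the empty set and no
denominators remain. -/
theorem aeval_polyComp {k : ℕ} {K : Type} [Field K] [Algebra ℚ K]
    (f : MvPolynomial (Fin k) ℚ →+* K) (ms : List ℕ) (m n : ℕ) :
    f (polyComp k ms m n) = (Fam.step^[(indices k).length] (gFam ms m n)).alt
      (fun i => f (MvPolynomial.X i)) (indices k) ∅ := by
  have := ((gFam_natural ms m n).iterate (indices k).length).eval f MvPolynomial.X (indices k) ∅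
  rw [polyComp, Fam.alt, altProd_empty, one_mul, ← this]
  rfl

theorem polyToLaurent_X {k : ℕ} (i : Fin k) : polyToLaurent k (MvPolynomial.X i) = mon i := by
  rw [← expand_algebraMap]
  exact expand_x i

theorem isAntipoly_sub_polyComp (k : ℕ) (ms : List ℕ) (m n : ℕ) :
    IsAntipoly ((gFam ms m n).alt (mon (k := k)) [] Finset.univ - polyToLaurent k (polyComp k ms m n)) := by
  rw [aeval_polyComp]
  simp only [polyToLaurent_X]
  have := Fam.isAntipoly_alt_sub_iterate (gFam_natural ms m n) (gFam_cancellative ms m n)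
    (indices k) (pairwise_indices k) ∅ (by simp)
  rwa [toFinset_indices_union] at this

/-- This transfers degree bounds from the expansion of $g$ to its polynomial component, and values
of the component back to coefficients of $g$. -/
theorem coeff_polyComp {k : ℕ} (ms : List ℕ) (m n : ℕ) (s : Fin k →₀ ℕ) :
    (polyComp k ms m n).coeff s =
      ((gFam ms m n).alt (mon (k := k)) [] Finset.univ).coeff (natExpo s) := by
  have h0 : ((gFam ms m n).alt (mon (k := k)) [] Finset.univ - polyToLaurent k (polyComp k ms m n)).coeff
      (natExpo s) = 0 := by
    by_contra hne
    obtain ⟨i, hi⟩ := isAntipoly_sub_polyComp k ms m n _ hne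
    exact absurd hi (by simp)
  rw [HahnSeries.coeff_sub, coeff_polyToLaurent, sub_eq_zero] at h0
  exact h0.symm

section
variable {k : ℕ} {ms : List ℕ} {m n : ℕ}

theorem totalDegree_polyComp_le (hms : ∀ a ∈ ms, 0 < a) (hm : ms.sum = m) (hmn : m ≤ n) :
    (polyComp k ms m n).totalDegree ≤ n := by
  refine Finset.sup_le fun s hs => ?_
  rw [MvPolynomial.mem_support_iff, coeff_polyComp] at hs
  have := wtLE_alt_gFam (k := k) hms hm hmn Finset.univ _ hs
  rw [natExpo, wt_expo] at this
  rw [Finsupp.sum_fintype _ _ (by simp)]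
  simpa [← Nat.cast_sum] using this

theorem eval_polyComp (hms : ∀ a ∈ ms, 0 < a) (hm : ms.sum = m)
    {c : Fin k → ℕ} (hc : ∑ i, c i ≤ n) :
    MvPolynomial.eval (fun i => (c i : ℚ)) (polyComp k ms m n) =
      (gFam ms m n).value c Finset.univ := by
  have hy := isCurve_genericCurve c
  have h1 := hy.tendsto_alt_iterate (n := n) (genericCurve_injective c) hms hm (indices k)
    (pairwise_indices k) ∅ (by simp) (by rwa [toFinset_indices_union])
  rw [toFinset_indices_union] at h1
  have h2 := hy.tendsto_aeval (polyComp k ms m n)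
  have h3 := tendsto_nhds_unique h2 (h1.congr fun t => ?_)
  · exact_mod_cast h3
  · have := aeval_polyComp (MvPolynomial.aeval (genericCurve c t) :
      MvPolynomial (Fin k) ℚ →ₐ[ℚ] ℝ).toRingHom ms m n
    simpa using this.symm

theorem polyComp_eq_sum (hms : ∀ a ∈ ms, 0 < a) (hm : ms.sum = m) (hmn : m ≤ n) :
    polyComp k ms m n = ∑ c ∈ Finset.piAntidiag (Finset.univ : Finset (Fin k)) n,
      MvPolynomial.C (((n - m).factorial : ℚ) / (∏ i, ((c i).factorial : ℚ)) *
        (psiFam ms).value c Finset.univ) * newton c := by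
  have h := eq_sum_newton (totalDegree_polyComp_le (k := k) hms hm hmn) fun c hc => by
    rw [eval_polyComp hms hm hc.le, value_gFam_of_lt hms hm hc]
  refine h.trans (Finset.sum_congr rfl fun c hc => ?_)
  have hc' : ∑ i, c i = n := (Finset.mem_piAntidiag.1 hc).1
  rw [eval_polyComp hms hm hc'.le, value_gFam_of_eq hmn hc', mul_div_right_comm]

theorem coeff_alt_gFam (hms : ∀ a ∈ ms, 0 < a) (hm : ms.sum = m) (hmn : m ≤ n)
    {d : Fin k → ℕ} (hd : ∑ i, d i = n) :
    ((gFam ms m n).alt (mon (k := k)) [] Finset.univ).coeff (expo fun i => (d i : ℤ)) =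
      ((n - m).factorial : ℚ) / (∏ i, ((d i).factorial : ℚ)) *
        (psiFam ms).value d Finset.univ := by
  have h := coeff_polyComp ms m n (Finsupp.equivFunOnFinite.symm d)
  rw [coeff_eq_eval_div (totalDegree_polyComp_le (k := k) hms hm hmn) (fun c hc => by
    rw [eval_polyComp hms hm hc.le, value_gFam_of_lt hms hm hc]) hd, eval_polyComp hms hm hd.le,
    value_gFam_of_eq hmn hd, mul_div_right_comm] at h
  exact h.symm

end

theorem phi_mul_ff_eq_alt {k : ℕ} {v : Fin k → ℕ} (hv : Antitone v) (m n : ℕ) :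
    phi v * ff ((∑ i, x i) - (m : RatFun k)) (n - m) =
      (gFam (parts v) m n).alt x [] Finset.univ := by
  rw [phi_eq_alt hv, Fam.alt, Fam.alt, gFam, List.map_nil, mul_assoc]
  rfl

end StrictPaths

/-! ### The path formula: initial values and recursion. -/

namespace StrictPaths

theorem altVal_eq_zero {k : ℕ} {c : Fin k → ℕ} {i j : Fin k} (hij : i ≠ j) (h : c i = c j)
    (h0 : c i ≠ 0) : altVal c Finset.univ = 0 := by
  wlog hlt : i < j generalizing i j
  · exact this hij.symm h.symm (h ▸ h0) (lt_of_le_of_ne (not_lt.1 hlt) hij.symm)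
  refine Finset.prod_eq_zero (Finset.mem_univ i) (Finset.prod_eq_zero (Finset.mem_univ j) ?_)
  rw [if_pos hlt, ratio, if_neg (fun h' => h0 h'.1), h, sub_self, zero_div]

/-- A non-zero term of the recursion has `c i ≥ m` and a remaining sum at least `ms.sum`; equality
of the totals forces `c i = m`. -/
theorem filter_map_eq_of_value_ne_zero {k : ℕ} (c : Fin k → ℕ) (ms : List ℕ)
    (hms : ∀ a ∈ ms, 0 < a) : ∀ S : Finset (Fin k), (psiFam ms).value c S ≠ 0 →
    ∑ i ∈ S, c i = ms.sum → (S.val.map c).filter (· ≠ 0) = (ms : Multiset ℕ) := by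
  induction ms with
  | nil =>
    intro S _ hS
    rw [List.sum_nil, Finset.sum_eq_zero_iff] at hS
    rw [Multiset.coe_nil, Multiset.filter_eq_nil]
    intro a ha
    obtain ⟨i, hi, rfl⟩ := Multiset.mem_map.1 ha
    exact not_not.2 (hS i hi)
  | cons m ms ih =>
    intro S h0 hS
    have hms' : ∀ a ∈ ms, 0 < a := fun a ha => hms a (by simp [ha])
    have hm : 0 < m := hms m (by simp)
    rw [value_psiFam_cons c S hm] at h0
    obtain ⟨i, hi, h0⟩ := Finset.exists_ne_zero_of_sum_ne_zero h0
    have h1 : m ≤ c i := by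
      by_contra hlt
      rw [Nat.descFactorial_of_lt (not_le.1 hlt)] at h0
      simp at h0
    have h2 := right_ne_zero_of_mul h0
    have h3 : ms.sum ≤ ∑ j ∈ S.erase i, c j := by
      by_contra hlt
      exact h2 (value_psiFam_eq_zero c ms hms' _ (not_le.1 hlt))
    rw [← Finset.add_sum_erase S c hi, List.sum_cons] at hS
    have h4 : c i = m := by omega
    rw [val_map_eq_cons c hi, Multiset.filter_cons_of_pos _ (by omega), ih hms' _ h2 (by omega),
      h4, Multiset.cons_coe]

/-- Only the first index `J` contributes to the recursion: later coordinates are strictly smaller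
than `v.1 J`, and the falling factorial kills them. -/
theorem value_parts_drop {k : ℕ} (v : SY k) (d : ℕ) : ∀ j, j + d = len v.1 →
    (psiFam ((parts v.1).drop j)).value v.1 (Finset.univ.filter fun i : Fin k => j ≤ (i : ℕ)) =
      ∏ i ∈ Finset.univ.filter (fun i : Fin k => j ≤ (i : ℕ)), ((v.1 i).factorial : ℚ) := by
  have hlen : (parts v.1).length = len v.1 := by
    simp [parts, len_le]
  induction d with
  | zero =>
    intro j hj
    rw [add_zero] at hj
    have hz : ∀ i ∈ Finset.univ.filter (fun i : Fin k => j ≤ (i : ℕ)), v.1 i = 0 := fun i hi => by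
      rw [Finset.mem_filter, hj, ← not_lt, lt_len_iff v.2.1, not_not] at hi
      exact hi.2
    rw [List.drop_eq_nil_of_le (by omega), Fam.value, psiFam, mul_one, altVal,
      Finset.prod_eq_one, Finset.prod_eq_one]
    · intro i hi
      simp [hz i hi]
    · intro i hi
      refine Finset.prod_eq_one fun l hl => ?_
      simp [hz i hi, hz l hl, ratio]
  | succ d ih =>
    intro j hj
    have hjl : j < len v.1 := by omega
    have hjk : j < k := hjl.trans_le (len_le v.1)
    set J : Fin k := ⟨j, hjk⟩ with hJ
    set S := Finset.univ.filter (fun i : Fin k => j ≤ (i : ℕ)) with hS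
    have hJS : J ∈ S := by simp [hS, hJ]
    have herase : S.erase J = Finset.univ.filter (fun i : Fin k => j + 1 ≤ (i : ℕ)) := by
      ext i
      simp only [hS, Finset.mem_erase, Finset.mem_filter, Finset.mem_univ, true_and, hJ, ne_eq,
        Fin.ext_iff]
      omega
    have h0 : v.1 J ≠ 0 := (lt_len_iff v.2.1 J).1 hjl
    have hdrop : (parts v.1).drop j = v.1 J :: (parts v.1).drop (j + 1) := by
      rw [List.drop_eq_getElem_cons (by omega)]
      simp [parts, hJ]
    rw [hdrop, value_psiFam_cons _ _ (Nat.pos_of_ne_zero h0),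
      Finset.sum_eq_single_of_mem J hJS, herase, ih (j + 1) (by omega), ← herase,
      Nat.descFactorial_self, posSign_eq_one, Int.cast_one, one_mul,
      Finset.mul_prod_erase S (fun i => ((v.1 i).factorial : ℚ)) hJS]
    · intro i hi
      exact Fin.le_def.2 (Finset.mem_filter.1 hi).2
    · intro i hi hne
      have hle : v.1 i ≤ v.1 J := v.2.1 (Fin.le_def.2 (Finset.mem_filter.1 hi).2)
      have hlt : v.1 i < v.1 J := lt_of_le_of_ne hle fun h =>
        h0 (v.2.2 J i hne.symm h.symm)
      rw [Nat.descFactorial_of_lt hlt]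
      simp

theorem value_parts_self {k : ℕ} (v : SY k) :
    (psiFam (parts v.1)).value v.1 Finset.univ = ∏ i, ((v.1 i).factorial : ℚ) := by
  simpa using value_parts_drop v (len v.1) 0 (by omega)

/-- The length `k` fixes the number of zeros, and a sorted vector is determined by its multiset of
coordinates. -/
theorem eq_of_filter_map_eq {k : ℕ} {u v : Fin k → ℕ} (hu : Antitone u) (hv : Antitone v)
    (h : (Finset.univ.val.map u).filter (· ≠ 0) = (Finset.univ.val.map v).filter (· ≠ 0)) :
    u = v := by
  have hrep : ∀ w : Fin k → ℕ, Finset.univ.val.map w =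
      (Finset.univ.val.map w).filter (· ≠ 0) +
        Multiset.replicate (k - Multiset.card ((Finset.univ.val.map w).filter (· ≠ 0))) 0 := by
    intro w
    have h1 := Multiset.filter_add_not (· ≠ 0) (Finset.univ.val.map w)
    have h2 : (Finset.univ.val.map w).filter (fun a => ¬ a ≠ 0) = Multiset.replicate
        (Multiset.card ((Finset.univ.val.map w).filter (fun a => ¬ a ≠ 0))) 0 :=
      Multiset.eq_replicate_card.2 fun a ha => not_not.1 (Multiset.mem_filter.1 ha).2
    have h3 := congrArg Multiset.card h1
    rw [Multiset.card_add, Multiset.card_map, Finset.card_val, Finset.card_univ,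
      Fintype.card_fin] at h3
    rw [h2] at h1
    conv_lhs => rw [← h1]
    congr 2
    omega
  have heq : Finset.univ.val.map u = Finset.univ.val.map v := by
    rw [hrep u, hrep v, h]
  have hperm : (List.ofFn u).Perm (List.ofFn v) := by
    rw [← Multiset.coe_eq_coe]
    simpa [Fin.univ_def, List.ofFn_eq_map] using heq
  have hs : ∀ w : Fin k → ℕ, Antitone w → (List.ofFn w).Pairwise (· ≥ ·) := fun w hw =>
    List.pairwise_ofFn.2 fun i j hij => hw hij.le
  exact List.ofFn_injective (hperm.eq_of_pairwise (fun a b _ _ h1 h2 => le_antisymm h2 h1)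
    (hs u hu) (hs v hv))

theorem value_parts_eq_zero {k : ℕ} {u v : SY k} (huv : u ≠ v)
    (h : ∑ i, u.1 i = ∑ i, v.1 i) : (psiFam (parts v.1)).value u.1 Finset.univ = 0 := by
  by_contra h0
  have hp : ∀ a ∈ parts v.1, 0 < a := fun a => pos_of_mem_parts v.2.1
  have h1 := filter_map_eq_of_value_ne_zero u.1 _ hp _ h0 (h.trans (sum_parts v.2.1).symm)
  have h2 := filter_map_eq_of_value_ne_zero v.1 _ hp Finset.univ (by
    rw [value_parts_self]
    exact Finset.prod_ne_zero_iff.2 fun i _ => by exact_mod_cast (v.1 i).factorial_ne_zero)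
    (sum_parts v.2.1).symm
  exact huv (Subtype.ext (eq_of_filter_map_eq u.2.1 v.2.1 (h1.trans h2.symm)))

/-- The expected number of paths from `v` to `u`. -/
noncomputable def pathFormula {k : ℕ} (v u : Fin k → ℕ) : ℚ :=
  ((∑ i, u i - ∑ i, v i).factorial : ℚ) / (∏ i, ((u i).factorial : ℚ)) *
    (psiFam (parts v)).value u Finset.univ

theorem pathFormula_self {k : ℕ} (v : SY k) : pathFormula v.1 v.1 = 1 := by
  rw [pathFormula, value_parts_self, Nat.sub_self, Nat.factorial_zero, Nat.cast_one,
    one_div_mul_cancel]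
  exact Finset.prod_ne_zero_iff.2 fun i _ => by exact_mod_cast (v.1 i).factorial_ne_zero

theorem coeff_alt_gFam_eq_pathFormula {k : ℕ} {v : Fin k → ℕ} (hv : Antitone v)
    {u : Fin k → ℕ} (huv : ∑ i, v i ≤ ∑ i, u i) :
    ((gFam (parts v) (∑ i, v i) (∑ i, u i)).alt (mon (k := k)) [] Finset.univ).coeff
      (expo fun i => (u i : ℤ)) = pathFormula v u :=
  coeff_alt_gFam (fun _ => pos_of_mem_parts hv) (sum_parts hv) huv rfl

theorem alt_gFam_succ {k : ℕ} (ms : List ℕ) {m n : ℕ} (hmn : m ≤ n) :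
    (gFam ms m (n + 1)).alt (mon (k := k)) [] Finset.univ =
      (gFam ms m n).alt (mon (k := k)) [] Finset.univ * (∑ i, mon i - (n : Laurent k)) := by
  have h1 : ((Finset.univ : Finset (Fin k)).val.map mon).sum = ∑ i, mon i := rfl
  have h2 : ∀ a : Laurent k, ff (a - (m : Laurent k)) (n + 1 - m) =
      ff (a - (m : Laurent k)) (n - m) * (a - (n : Laurent k)) := fun a => by
    rw [ff, Nat.succ_sub hmn, descPochhammer_succ_eval, ff, Nat.cast_sub hmn, sub_sub,
      add_sub_cancel]
  simp only [Fam.alt, gFam, h1, h2]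
  ring

/-- Giving weight $-1$ to the variables from `i` on keeps the weights non-increasing, so every
factor has weight at most zero. -/
theorem coeff_alt_eq_zero_of_tail {k : ℕ} {h : Fam} (hh : h.IsNatural) (c : Fin k → ℤ) (i : Fin k)
    (hc : ∑ j ∈ Finset.Ici i, c j < 0) :
    (h.alt (mon (k := k)) [] Finset.univ).coeff (expo c) = 0 := by
  by_contra h0
  have := hh.wtLE_alt (w := fun j => if i ≤ j then -1 else 0) (T := []) (S := Finset.univ)
    (by simp) (fun j _ => by split_ifs <;> simp) (fun a _ b _ hab => by
      by_cases ha : i ≤ a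
      · simp [ha, ha.trans hab.le]
      · simp only [ha, if_false]
        split_ifs <;> simp) _ h0
  rw [wt_expo] at this
  simp only [ite_mul, neg_one_mul, zero_mul, ← Finset.sum_filter] at this
  rw [Finset.filter_le_eq_Ici, Finset.sum_neg_distrib] at this
  omega

/-- Compare coefficients of $x^u$ in $g_{n+1}=g_n\cdot(\sum x_i-n)$; the constant $n$ contributes
nothing, because $g_n$ has degree at most $n$. -/
theorem pathFormula_succ {k : ℕ} {v u : Fin k → ℕ} (hv : Antitone v) (hu : Antitone u)
    (huv : ∑ i, v i < ∑ i, u i) :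
    pathFormula v u =
      ∑ i, if u i = 0 then 0 else pathFormula v (u - Pi.single i 1) := by
  obtain ⟨n, hn⟩ : ∃ n, ∑ i, u i = n + 1 := ⟨∑ i, u i - 1, by omega⟩
  have hvn : ∑ i, v i ≤ n := by omega
  have hp : ∀ a ∈ parts v, 0 < a := fun a => pos_of_mem_parts hv
  have hdeg : ((gFam (parts v) (∑ i, v i) n).alt (mon (k := k)) [] Finset.univ).coeff
      (expo fun i => (u i : ℤ)) = 0 := by
    by_contra h0
    have := wtLE_alt_gFam hp (sum_parts hv) hvn Finset.univ _ h0
    rw [wt_expo] at this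
    simp only [Pi.one_apply, one_mul, ← Nat.cast_sum, hn] at this
    omega
  rw [← coeff_alt_gFam_eq_pathFormula hv huv.le, hn, alt_gFam_succ _ hvn, mul_sub, Finset.mul_sum,
    HahnSeries.coeff_sub, HahnSeries.coeff_sum]
  have hnat : (n : Laurent k) = HahnSeries.single 0 (n : ℚ) := by
    rw [← HahnSeries.C_apply, map_natCast]
  rw [hnat, HahnSeries.coeff_mul_single_zero, hdeg, zero_mul, sub_zero]
  refine Finset.sum_congr rfl fun i _ => ?_
  rw [mon, HahnSeries.coeff_mul_single, mul_one]
  have hsub : expo (fun i => (u i : ℤ)) - expo (Pi.single i 1) =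
      expo (fun j => (u j : ℤ) - (Pi.single i 1 : Fin k → ℤ) j) := rfl
  rw [hsub]
  split_ifs with hi
  -- Here `u` vanishes from `i` on, so the exponents from `i` on sum to $-1$.
  · refine coeff_alt_eq_zero_of_tail (gFam_natural _ _ _) _ i ?_
    have hz : ∑ j ∈ Finset.Ici i, (u j : ℤ) = 0 := Finset.sum_eq_zero fun j hj => by
      have := hu (Finset.mem_Ici.1 hj)
      omega
    rw [Finset.sum_sub_distrib, hz]
    simp
  · have hle : (Pi.single i 1 : Fin k → ℕ) ≤ u := by
      intro j
      by_cases hj : j = i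
      · subst hj; simp; omega
      · simp [hj]
    have hs : ∑ j, (u - Pi.single i 1 : Fin k → ℕ) j = n := by
      have h1 : ∑ j, (u - Pi.single i 1 : Fin k → ℕ) j + ∑ j, (Pi.single i 1 : Fin k → ℕ) j = n + 1 := by
        rw [← Finset.sum_add_distrib, ← hn]
        exact Finset.sum_congr rfl fun j _ => Nat.sub_add_cancel (hle j)
      simpa using h1
    rw [← coeff_alt_gFam_eq_pathFormula hv (hs.symm ▸ hvn), hs]
    congr 2
    ext j
    rw [Pi.sub_apply, Nat.cast_sub (hle j)]
    by_cases hj : j = i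
    · subst hj; simp
    · simp [hj]

/-! ### Counting paths by their last edge. -/

theorem sum_eq_of_hom {k : ℕ} {a b : SY k} (e : a ⟶ b) : ∑ i, b.1 i = ∑ i, a.1 i + 1 := by
  rw [e.2]
  simp [Finset.sum_add_distrib]

theorem sum_eq_of_path {k : ℕ} {a b : SY k} (p : Quiver.Path a b) :
    ∑ i, b.1 i = ∑ i, a.1 i + p.length := by
  induction p with
  | nil => simp
  | cons p e ih => rw [sum_eq_of_hom e, ih, Quiver.Path.length_cons, add_assoc]

/-- Paths from `v` to `u` whose last edge increases the coordinate `i`. -/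
def LastStep {k : ℕ} (v u : SY k) (i : Fin k) : Type :=
  {q : Σ b : SY k, Quiver.Path v b // u.1 = q.1.1 + Pi.single i 1}

theorem cons_bijective {k : ℕ} {v u : SY k} (h : ∑ i, v.1 i < ∑ i, u.1 i) :
    Function.Bijective fun q : (Σ i, LastStep v u i) =>
      (q.2.1.2.cons ⟨q.1, q.2.2⟩ : Quiver.Path v u) := by
  constructor
  · rintro ⟨i, ⟨b, p⟩, hb⟩ ⟨i', ⟨b', p'⟩, hb'⟩ hq
    simp only [Quiver.Path.cons.injEq] at hq
    obtain ⟨rfl, hp, he⟩ := hq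
    obtain rfl := eq_of_heq hp
    have he' := congrArg Subtype.val (eq_of_heq he)
    simp only at he'
    subst he'
    rfl
  · intro p
    cases p with
    | nil => exact absurd h (lt_irrefl _)
    | cons p e => exact ⟨⟨e.1, ⟨⟨_, p⟩, e.2⟩⟩, rfl⟩

theorem lastStep_bijective {k : ℕ} {v u b : SY k} {i : Fin k} (h : u.1 = b.1 + Pi.single i 1) :
    Function.Bijective fun p : Quiver.Path v b => (⟨⟨b, p⟩, h⟩ : LastStep v u i) := by
  constructor
  · intro p p' hp
    simpa [LastStep] using congrArg Subtype.val hp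
  · rintro ⟨⟨b', p⟩, hb'⟩
    obtain rfl : b' = b := Subtype.ext (add_right_cancel (hb'.symm.trans h))
    exact ⟨p, rfl⟩

/-- The previous vertex can only be $u-e_i$. If this is not a vertex, there are no such paths, and
the formula vanishes as well. -/
theorem card_lastStep {k : ℕ} {v u : SY k}
    (ih : ∀ b : SY k, ∑ i, b.1 i + 1 = ∑ i, u.1 i →
      Finite (Quiver.Path v b) ∧ (Nat.card (Quiver.Path v b) : ℚ) = pathFormula v.1 b.1)
    (i : Fin k) : Finite (LastStep v u i) ∧ (Nat.card (LastStep v u i) : ℚ) =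
      if u.1 i = 0 then 0 else pathFormula v.1 (u.1 - Pi.single i 1) := by
  by_cases hb : ∃ b : SY k, u.1 = b.1 + Pi.single i 1
  · obtain ⟨b, hb⟩ := hb
    obtain ⟨hfin, hcard⟩ := ih b (sum_eq_of_hom (⟨i, hb⟩ : b ⟶ u)).symm
    have e : Quiver.Path v b ≃ LastStep v u i := Equiv.ofBijective _ (lastStep_bijective (v := v) hb)
    refine ⟨Finite.of_equiv _ e, ?_⟩
    rw [← Nat.card_congr e, hcard, if_neg (by rw [hb]; simp), hb, add_tsub_cancel_right]
  · have hempty : IsEmpty (LastStep v u i) := ⟨fun q => hb ⟨q.1.1, q.2⟩⟩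
    refine ⟨inferInstance, ?_⟩
    rw [Nat.card_of_isEmpty, Nat.cast_zero]
    split_ifs with hi
    · rfl
    · have hle : (Pi.single i 1 : Fin k → ℕ) ≤ u.1 := by
        intro j
        by_cases hj : j = i
        · subst hj; simp; omega
        · simp [hj]
      -- As non-zero coordinates of `u` are distinct, $u-e_i$ is still non-increasing. It can fail
      -- to be a vertex only by having two equal non-zero coordinates, and then `altVal` is zero.
      have hanti : Antitone (u.1 - Pi.single i 1 : Fin k → ℕ) := by
        intro a b hab
        have h1 := u.2.1 hab
        have h2 := u.2.2 a b
        simp only [Pi.sub_apply, Pi.single_apply]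
        split_ifs with h3 h4 h4
        · omega
        · omega
        · subst h4
          have := h2 (Ne.symm h3)
          omega
        · omega
      have hne : ∃ a b, a ≠ b ∧ (u.1 - Pi.single i 1 : Fin k → ℕ) a = (u.1 - Pi.single i 1 : Fin k → ℕ) b ∧
            (u.1 - Pi.single i 1 : Fin k → ℕ) a ≠ 0 := by
        by_contra hcon
        push Not at hcon
        exact hb ⟨⟨_, hanti, hcon⟩, (tsub_add_cancel_of_le hle).symm⟩
      obtain ⟨a, b, hab, heq, h0⟩ := hne
      rw [pathFormula, Fam.value, altVal_eq_zero hab heq h0, zero_mul, mul_zero]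

theorem card_path {k : ℕ} (v : SY k) (d : ℕ) : ∀ u : SY k, ∑ i, u.1 i = ∑ i, v.1 i + d →
    Finite (Quiver.Path v u) ∧ (Nat.card (Quiver.Path v u) : ℚ) = pathFormula v.1 u.1 := by
  induction d with
  | zero =>
    intro u hu
    have hlen : ∀ p : Quiver.Path v u, p.length = 0 := fun p => by
      have := sum_eq_of_path p
      omega
    by_cases huv : u = v
    · subst huv
      have huniq : Unique (Quiver.Path u u) :=
        ⟨⟨Quiver.Path.nil⟩, fun p => Quiver.Path.eq_nil_of_length_zero p (hlen p)⟩
      exact ⟨inferInstance, by rw [Nat.card_unique, pathFormula_self, Nat.cast_one]⟩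
    · have hempty : IsEmpty (Quiver.Path v u) :=
        ⟨fun p => huv (Quiver.Path.eq_of_length_zero p (hlen p)).symm⟩
      refine ⟨inferInstance, ?_⟩
      rw [Nat.card_of_isEmpty, pathFormula, value_parts_eq_zero huv hu, mul_zero, Nat.cast_zero]
  | succ d ih =>
    intro u hu
    have hlt : ∑ i, v.1 i < ∑ i, u.1 i := by omega
    have hstep := card_lastStep (v := v) (u := u) fun b hb => ih b (by omega)
    have e : (Σ i, LastStep v u i) ≃ Quiver.Path v u := Equiv.ofBijective _ (cons_bijective hlt)
    have hfin : ∀ i, Finite (LastStep v u i) := fun i => (hstep i).1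
    refine ⟨Finite.of_equiv _ e, ?_⟩
    rw [← Nat.card_congr e, Nat.card_sigma, Nat.cast_sum, pathFormula_succ v.2.1 u.2.1 hlt]
    exact Finset.sum_congr rfl fun i _ => (hstep i).2

end StrictPaths

theorem mainTheorem2 (k : ℕ) (v u : SY k) (hvu : ∀ i, v.1 i ≤ u.1 i)
    (m n : ℕ) (hm : m = ∑ i, v.1 i) (hn : n = ∑ i, u.1 i)
    (g : RatFun k) (hg : g = phi v.1 * ff ((∑ i, x i) - (m : RatFun k)) (n - m)) :
    (∃ ψ : MvPolynomial (Fin k) ℚ, algebraMap _ (RatFun k) ψ = psi v.1) ∧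
    ∃ (φ : (Fin k → ℕ) → ℚ) (P : MvPolynomial (Fin k) ℚ) (Q : RatFun k),
      (∀ c, HasValueAt (phi v.1) c (φ c)) ∧
      IsDecomposition g P Q ∧
      (∀ c : Fin k → ℕ, ∑ i, c i ≤ n → HasValueAt Q c 0) ∧
      P = ∑ c ∈ Finset.piAntidiag (Finset.univ : Finset (Fin k)) n,
        MvPolynomial.C (((n - m).factorial : ℚ) / (∏ i, ((c i).factorial : ℚ)) * φ c) *
          ∏ i, ff (MvPolynomial.X i) (c i) ∧
      Finite (Quiver.Path v u) ∧
      (Nat.card (Quiver.Path v u) : ℚ) =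
        ((n - m).factorial : ℚ) / (∏ i, ((u.1 i).factorial : ℚ)) * φ u.1 := by
  have hmn : m ≤ n := hm ▸ hn ▸ Finset.sum_le_sum fun i _ => hvu i
  have hms : ∀ a ∈ parts v.1, 0 < a := fun a => pos_of_mem_parts v.2.1
  have hsum : (parts v.1).sum = m := (sum_parts v.2.1).trans hm.symm
  rw [phi_mul_ff_eq_alt v.2.1] at hg
  have hpath := card_path v (n - m) u (by omega)
  refine ⟨⟨psiPoly k (parts v.1), algebraMap_psiPoly v.2.1⟩,
    fun c => (psiFam (parts v.1)).value c Finset.univ, polyComp k (parts v.1) m n,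
    g - algebraMap _ (RatFun k) (polyComp k (parts v.1) m n), fun c => ?_, ⟨by ring, ?_⟩,
    fun c hc => ?_, polyComp_eq_sum hms hsum hmn, hpath.1, ?_⟩
  · rw [phi_eq_alt v.2.1]
    exact (psiFam_natural _).hasValueAt c
  · rw [map_sub, hg, (gFam_natural _ _ _).expand_alt, expand_algebraMap]
    exact isAntipoly_sub_polyComp k (parts v.1) m n
  · have := (gFam_natural (parts v.1) m n).hasValueAt_sub c (polyComp k (parts v.1) m n)
    rwa [eval_polyComp hms hsum hc, sub_self, ← hg] at this
  · rw [hpath.2, pathFormula, ← hm, ← hn]
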